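/- **Setting.** Let $Y = X\beta + \varepsilon$, where $X$ is a known $n\times p$ matrix with linearly independent columns, $\beta\in\mathbb{R}^p$ is unknown, $\varepsilon\sim N(0,\sigma^2 I_n)$ with $\sigma>0$, and $m=n-p\ge 1$. Let $\theta=a^T\beta$ and $\tau=C^T\beta-t$, where $C$ is a $p\times s$ matrix with linearly independent columns, $s\ge 2$, $t\in\mathbb{R}^s$, and $a\in\mathbb{R}^p$ does not belong to the column space of $C$. Let $\alpha\in(0,1)$ and $\ell>0$. Put $v_{11}=a^T(X^TX)^{-1}a$, $v_{21}=C^T(X^TX)^{-1}a$, $V_{22}=C^T(X^TX)^{-1}C$. Let $R(\beta)=(Y-X\beta)^T(Y-X\beta)$, let $\hat\beta=(X^TX)^{-1}X^TY$ be the least squares estimator, and let $\hat\tau=C^T\hat\beta-t$, $\hat\Theta=a^T\hat\beta$, $\hat\Sigma=\sqrt{R(\hat\beta)/m}$. Let $\beta^*=\hat\beta-(X^TX)^{-1}CV_{22}^{-1}\hat\tau$ be the minimizer of $R$ subject to $C^T\beta=t$, let $\Theta^*=a^T\beta^*$, and let $$F=\frac{(\hat\beta-\beta^*)^TX^TX(\hat\beta-\beta^*)/s}{\hat\Sigma^2}.$$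 Let $t(k)$ satisfy $P(-t(k)\le T\le t(k))=1-\alpha$ for $T\sim t_k$. With $[x\pm y]=[x-y,x+y]$, let $$I=\left[\hat\Theta\pm t(m)\sqrt{v_{11}}\,\hat\Sigma\right],\qquad J=\left[\Theta^*\pm t(m+s)\sqrt{\tfrac{R(\beta^*)}{m+s}}\sqrt{v_{11}-v_{21}^TV_{22}^{-1}v_{21}}\right].$$ The naive $1-\alpha$ confidence interval for $\theta$ is $I$ if $F>\ell$ and $J$ if $F\le\ell$. **Notation.** Let $b=v_{11}^{-1/2}V_{22}^{-1/2}v_{21}$ and $\gamma=\sigma^{-1}V_{22}^{-1/2}\tau$, and let $\|\cdot\|$ be the Euclidean norm. Let $\psi=b^T\gamma/(\|b\|\,\|\gamma\|)$ if $b\neq0$ and $\gamma\ne 0$, $\psi=1$ if $\gamma=0$, and $\psi=0$ if $b=0\neq\gamma$ (in that last case the value is immaterial). Let $f_W$ be the density of $W=\hat\Sigma/\sigma$, $f_R$ the density of $\sqrt{R^2}$ for $R^2\sim\chi^2_s$, and $f_Q$ the density of the noncentral $\chi^2$ distribution with $s$ degrees of freedom and noncentrality parameter $\|\gamma\|^2$.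 For $0\le t_1,t_2\le 1$ let $$f_{T_1}(t_1)=\frac{\pi}{B(\frac12,\frac{s-1}2)}\sin^{s-2}(\pi t_1),\qquad f_{T_2}(t_2)=\frac{\pi}{B(\frac12,\frac{s-2}2)}\sin^{s-3}(\pi t_2)\ \ (s\ge3),$$ where $B$ is the beta function. With $Z\sim N(0,1-\|b\|^2)$ let $$i(x,w)=P\left(-t(m)w+x\le Z\le t(m)w+x\right),\quad j(x,y,w)=P\left(Z\in\left[x\pm t(m+s)\sqrt{\tfrac{mw^2+y}{m+s}}\sqrt{1-\|b\|^2}\right]\right).$$ Let $d(t_1,r)=\|\gamma\|^2+2\|\gamma\|r\cos(2\pi t_1)+r^2$ if $s=2$ and $d(t_1,r)=\|\gamma\|^2+2\|\gamma\|r\cos(\pi t_1)+r^2$ if $s\ge3$, and let $u=\sqrt{d(t_1,r)/(s\ell)}$. Let $k(t_1)=\psi\cos(2\pi t_1)+\sqrt{1-\psi^2}\sin(2\pi t_1)$, and let $k(t_1,t_2)=\psi\cos(\pi t_1)+\sqrt{1-\psi^2}\sin(\pi t_1)\cos(2\pi t_2)$ if $s=3$ and $k(t_1,t_2)=\psi\cos(\pi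 t_1)+\sqrt{1-\psi^2}\sin(\pi t_1)\cos(\pi t_2)$ if $s\ge4$. **Theorem.** The densities $f_W$, $f_R$, $f_Q$ exist, and the coverage probability of the naive $1-\alpha$ confidence interval is $P(\theta\in I,F>\ell)+P(\theta\in J,F\le\ell)$. The second term is $$P(\theta\in J,F\le\ell)=\int_0^\infty\int_0^{s\ell w^2} j(\|b\|\,\|\gamma\|\,\psi,q,w)\,f_Q(q)\,f_W(w)\,dq\,dw.$$ The first term is given as follows. 1. If $s=2$, $$P(\theta\in I,F>\ell)=\int_0^1\int_0^\infty\int_0^u i(-\|b\|\,r\,k(t_1),w)\,f_W(w)f_R(r)\,dw\,dr\,dt_1.$$ 2. If $s\ge3$ and $\|\gamma\|>0$, $$P(\theta\in I,F>\ell)=\int_0^1\int_0^1\int_0^\infty\int_0^u i(-\|b\|\,r\,k(t_1,t_2),w)\,f_W(w)f_R(r)f_{T_1}(t_1)f_{T_2}(t_2)\,dw\,dr\,dt_1\,dt_2.$$ 3. If $s\ge3$, $\|\gamma\|>0$ and $\psi\in\{-1,1\}$, $$P(\theta\in I,F>\ell)=\int_0^1\int_0^\infty\int_0^u i(-\|b\|\,r\cos(\pi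 t_1),w)\,f_W(w)f_R(r)f_{T_1}(t_1)\,dw\,dr\,dt_1.$$ 4. If $\|\gamma\|=0$ and $s=2$, $$P(\theta\in I,F>\ell)=\int_0^1\int_0^\infty\int_0^{r/\sqrt{s\ell}} i(-\|b\|\,r\cos(2\pi t_1),w)\,f_W(w)f_R(r)\,dw\,dr\,dt_1.$$ 5. If $\|\gamma\|=0$ and $s\ge3$, $$P(\theta\in I,F>\ell)=\int_0^1\int_0^\infty\int_0^{r/\sqrt{s\ell}} i(-\|b\|\,r\cos(\pi t_1),w)\,f_W(w)f_R(r)f_{T_1}(t_1)\,dw\,dr\,dt_1.$$ For given $\|b\|$, $m$, $s$, $\ell$ and $\alpha$, the coverage probability is a function of $(\|\gamma\|,\psi)$: there is a function $c$, depending only on $m,s,\ell,\alpha$, such that for all $n,p,X,a,C,t,\beta,\sigma$ as above the coverage probability equals $c(\|b\|,\|\gamma\|,\psi)$. -/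

import Mathlib

open MeasureTheory ProbabilityTheory Matrix
open scoped ENNReal MatrixOrder

noncomputable section

/-! ### Distributions -/

/-- The `χ²` distribution with `k` degrees of freedom: the law of the sum of the squares of `k`
independent standard normal variables. -/
def chiSquared (k : ℕ) : Measure ℝ :=
  (stdGaussian (EuclideanSpace ℝ (Fin k))).map fun z => ∑ i, z i ^ 2

/-- The noncentral `χ²` distribution with `k ≥ 1` degrees of freedom and noncentrality parameter
`lam ≥ 0`: the law of `(Z₁ + √lam)² + Z₂² + ⋯ + Z_k²`, with `Z₁, …, Z_k` independent standard
normal variables. -/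
def noncentralChiSquared (k : ℕ) (lam : ℝ) : Measure ℝ :=
  (stdGaussian (EuclideanSpace ℝ (Fin k))).map
    fun z => ∑ i, (z i + if i.val = 0 then √lam else 0) ^ 2

/-- Student's `t` distribution with `k ≥ 1` degrees of freedom: the law of `Z / √(V / k)` with
`Z` standard normal, `V ∼ χ²_k`, and `Z`, `V` independent. -/
def studentT (k : ℕ) : Measure ℝ :=
  ((gaussianReal 0 1).prod (chiSquared k)).map fun x => x.1 / √(x.2 / k)

/-- The quantile `t(k)`, determined (for `0 < α < 1`) by
`P(-t(k) ≤ T ≤ t(k)) = 1 - α` for `T ∼ t_k`. -/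
def tQuantile (α : ℝ) (k : ℕ) : ℝ :=
  sInf {x : ℝ | 0 ≤ x ∧ 1 - α ≤ (studentT k).real (Set.Icc (-x) x)}

theorem isProbabilityMeasure_chiSquared (k : ℕ) : IsProbabilityMeasure (chiSquared k) :=
  Measure.isProbabilityMeasure_map (by fun_prop)

theorem isProbabilityMeasure_studentT (k : ℕ) : IsProbabilityMeasure (studentT k) := by
  have := isProbabilityMeasure_chiSquared k
  exact Measure.isProbabilityMeasure_map (by fun_prop)

theorem chiSquared_Iic_zero {k : ℕ} (hk : 0 < k) : chiSquared k (Set.Iic 0) = 0 := by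
  rw [chiSquared, Measure.map_apply (by fun_prop) measurableSet_Iic]
  have h1 := (measurePreserving_eval_multivariateGaussian (μ := 0)
    (Matrix.PosSemidef.one (n := Fin k) (R := ℝ)) (i := ⟨0, hk⟩)).map_eq
  rw [multivariateGaussian_zero_one] at h1
  refine measure_mono_null (t := (fun z : EuclideanSpace ℝ (Fin k) => z.ofLp ⟨0, hk⟩) ⁻¹' {0})
    (fun z hz => ?_) ?_
  · have h0 : ∑ i, z i ^ 2 = 0 := le_antisymm hz (Finset.sum_nonneg fun i _ => sq_nonneg _)
    have := (Finset.sum_eq_zero_iff_of_nonneg fun i _ => sq_nonneg _).1 h0 ⟨0, hk⟩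
      (Finset.mem_univ _)
    simpa using this
  · rw [← Measure.map_apply (by fun_prop) (measurableSet_singleton _), h1]
    have := nullSingletonClass_gaussianReal (μ := 0) (v := 1) one_ne_zero
    simp

theorem studentT_singleton {k : ℕ} (hk : 0 < k) (c : ℝ) : studentT k {c} = 0 := by
  have := isProbabilityMeasure_chiSquared k
  have := nullSingletonClass_gaussianReal (μ := 0) (v := 1) one_ne_zero
  have hm : Measurable fun x : ℝ × ℝ => x.1 / √(x.2 / k) := by fun_prop
  rw [studentT, Measure.map_apply hm (measurableSet_singleton _),
    Measure.prod_apply_symm (hm (measurableSet_singleton _)), lintegral_eq_zero_iff'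
      (measurable_measure_prodMk_right (hm (measurableSet_singleton _))).aemeasurable]
  have h : ∀ᵐ v ∂chiSquared k, 0 < v := by
    simpa [ae_iff, Set.Iic] using chiSquared_Iic_zero hk
  filter_upwards [h] with v hv
  refine measure_mono_null (t := {c * √(v / k)}) (fun z hz => ?_) (measure_singleton _)
  have hv' : √(v / k) ≠ 0 := (Real.sqrt_pos.2 (by positivity)).ne'
  have hz' : z / √(v / k) = c := hz
  rw [Set.mem_singleton_iff, ← hz', div_mul_cancel₀ _ hv']

/-- The defining property of `t(k)`. -/
theorem studentT_tQuantile {α : ℝ} (hα₀ : 0 < α) (hα₁ : α < 1) {k : ℕ} (hk : 0 < k) :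
    (studentT k).real (Set.Icc (-tQuantile α k) (tQuantile α k)) = 1 - α := by
  have := isProbabilityMeasure_studentT k
  have hmA : Measurable fun x : ℝ => |x| := by fun_prop
  set ν := (studentT k).map fun x => |x| with hν
  have : IsProbabilityMeasure ν := Measure.isProbabilityMeasure_map hmA.aemeasurable
  have hG : ∀ x, (studentT k).real (Set.Icc (-x) x) = cdf ν x := by
    intro x
    rw [cdf_eq_real, hν, map_measureReal_apply hmA measurableSet_Iic]
    congr 1; ext z; simp [abs_le]
  have hν0 : ∀ c, ν {c} = 0 := by
    intro c
    rw [hν, Measure.map_apply hmA (measurableSet_singleton _)]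
    refine measure_mono_null (t := {c} ∪ {-c}) (fun z hz => ?_)
      (measure_union_null (studentT_singleton hk _) (studentT_singleton hk _))
    have hz' : |z| = c := hz
    rcases abs_choice z with h | h
    · exact Or.inl (show z = c by linarith)
    · exact Or.inr (show z = -c by linarith)
  have hc : Continuous (cdf ν) := by
    refine continuous_iff_continuousAt.2 fun x => ?_
    have h := hν0 x
    rw [← measure_cdf ν, StieltjesFunction.measure_singleton, ENNReal.ofReal_eq_zero] at h
    rw [(monotone_cdf ν).continuousAt_iff_leftLim_eq_rightLim, StieltjesFunction.rightLim_eq]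
    exact le_antisymm ((monotone_cdf ν).leftLim_le le_rfl) (by linarith)
  have h0 : cdf ν 0 = 0 := by
    rw [← hG]; simp [measureReal_def, studentT_singleton hk]
  obtain ⟨M, hM⟩ := ((tendsto_cdf_atTop ν).eventually (lt_mem_nhds (show 1 - α < 1 by linarith))).exists
  simp only [tQuantile, hG]
  set S := {x : ℝ | 0 ≤ x ∧ 1 - α ≤ cdf ν x} with hS
  have hM0 : 0 ≤ M := by
    by_contra! h
    have := monotone_cdf ν h.le
    linarith
  have hne : S.Nonempty := ⟨M, hM0, hM.le⟩
  have hbd : BddBelow S := ⟨0, fun x hx => hx.1⟩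
  have hcl : IsClosed S := (isClosed_le continuous_const continuous_id).inter
    (isClosed_le continuous_const hc)
  have hmem := hcl.csInf_mem hne hbd
  refine le_antisymm ?_ hmem.2
  by_contra! h
  obtain ⟨y, hy, hy'⟩ := intermediate_value_Icc hmem.1 hc.continuousOn
    (show 1 - α ∈ Set.Icc (cdf ν 0) (cdf ν (sInf S)) from ⟨by linarith, hmem.2⟩)
  have h1 : sInf S ≤ y := csInf_le hbd ⟨hy.1, hy'.ge⟩
  have h2 : y = sInf S := le_antisymm hy.2 h1
  rw [h2] at hy'
  linarith

/-- The (Lebesgue) probability density function of a distribution on the real line. -/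
def density (μ : Measure ℝ) (x : ℝ) : ℝ := (μ.rnDeriv volume x).toReal

/-- The law of `√(R²)` when `R² ∼ χ²_s`. -/
def chiLaw (s : ℕ) : Measure ℝ := (chiSquared s).map Real.sqrt

/-- The density `f_R`. -/
def fR (s : ℕ) : ℝ → ℝ := density (chiLaw s)

/-- The density `f_Q`; `g` stands for `‖γ‖`. -/
def fQ (s : ℕ) (g : ℝ) : ℝ → ℝ := density (noncentralChiSquared s (g ^ 2))

/-- The density `f_{T₁}` (for `s ≥ 2`). -/
def fT₁ (s : ℕ) (t₁ : ℝ) : ℝ :=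
  if 0 ≤ t₁ ∧ t₁ ≤ 1 then
    Real.pi / beta (1 / 2) (((s : ℝ) - 1) / 2) * Real.sin (Real.pi * t₁) ^ (s - 2)
  else 0

/-- The density `f_{T₂}` (for `s ≥ 3`). -/
def fT₂ (s : ℕ) (t₂ : ℝ) : ℝ :=
  if 0 ≤ t₂ ∧ t₂ ≤ 1 then
    Real.pi / beta (1 / 2) (((s : ℝ) - 2) / 2) * Real.sin (Real.pi * t₂) ^ (s - 3)
  else 0

/-! ### The functions `i`, `j`, `d`, `k` -/

/-- `i(x, w; ‖b‖) = P(-t(m) w + x ≤ Z ≤ t(m) w + x)`, `Z ∼ N(0, 1 - ‖b‖²)`; `B` stands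
for `‖b‖`. -/
def iProb (α : ℝ) (m : ℕ) (B x w : ℝ) : ℝ :=
  (gaussianReal 0 (1 - B ^ 2).toNNReal).real
    (Set.Icc (-tQuantile α m * w + x) (tQuantile α m * w + x))

/-- `j(x, y, w; ‖b‖)`, the probability that `Z ∼ N(0, 1 - ‖b‖²)` lies in
`[x ± t(m+s) √((m w² + y) / (m + s)) √(1 - ‖b‖²)]`; `B` stands for `‖b‖`. -/
def jProb (α : ℝ) (m s : ℕ) (B x y w : ℝ) : ℝ :=
  (gaussianReal 0 (1 - B ^ 2).toNNReal).real
    (Set.Icc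
      (x - tQuantile α (m + s) * √((m * w ^ 2 + y) / (m + s)) * √(1 - B ^ 2))
      (x + tQuantile α (m + s) * √((m * w ^ 2 + y) / (m + s)) * √(1 - B ^ 2)))

/-- `d(t₁, r; s, ‖γ‖)` (for `s ≥ 2`); `g` stands for `‖γ‖`. -/
def dFun (s : ℕ) (g t₁ r : ℝ) : ℝ :=
  if s = 2 then g ^ 2 + 2 * g * r * Real.cos (2 * Real.pi * t₁) + r ^ 2
  else g ^ 2 + 2 * g * r * Real.cos (Real.pi * t₁) + r ^ 2

/-- The upper limit `u = √(d(t₁, r; s, ‖γ‖) / (s ℓ))`. -/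
def uFun (s : ℕ) (ℓ g t₁ r : ℝ) : ℝ := √(dFun s g t₁ r / (s * ℓ))

/-- `k(t₁; ψ)`, used for `s = 2`. -/
def kTwo (ψ t₁ : ℝ) : ℝ :=
  ψ * Real.cos (2 * Real.pi * t₁) + √(1 - ψ ^ 2) * Real.sin (2 * Real.pi * t₁)

/-- `k(t₁, t₂; s, ψ)`, used for `s ≥ 3`. -/
def kFun (s : ℕ) (ψ t₁ t₂ : ℝ) : ℝ :=
  if s = 3 then
    ψ * Real.cos (Real.pi * t₁)
      + √(1 - ψ ^ 2) * Real.sin (Real.pi * t₁) * Real.cos (2 * Real.pi * t₂)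
  else
    ψ * Real.cos (Real.pi * t₁)
      + √(1 - ψ ^ 2) * Real.sin (Real.pi * t₁) * Real.cos (Real.pi * t₂)

/-! ### The regression problem -/

/-- The known quantities of the problem. The last two fields imply `a ≠ 0` and `s < p`. -/
structure Regression (n p s : ℕ) where
  /-- the design matrix -/
  X : Matrix (Fin n) (Fin p) ℝ
  /-- the vector that defines the parameter of interest `θ = aᵀβ` -/
  a : Fin p → ℝ
  /-- the matrix that defines `τ = Cᵀβ - t` -/
  C : Matrix (Fin p) (Fin s) ℝ
  /-- the vector that defines `τ = Cᵀβ - t` -/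
  t : Fin s → ℝ
  linearIndependent_X : LinearIndependent ℝ X.col
  linearIndependent_C : LinearIndependent ℝ C.col
  a_notMem_span : a ∉ Submodule.span ℝ (Set.range C.col)

namespace Regression

variable {n p s : ℕ} (D : Regression n p s)

/-- The law `N(Xβ, σ² Iₙ)` of the response vector `Y = Xβ + ε`, `ε ∼ N(0, σ² Iₙ)`. -/
def law (β : Fin p → ℝ) (σ : ℝ) : Measure (EuclideanSpace ℝ (Fin n)) :=
  multivariateGaussian (WithLp.toLp 2 (D.X *ᵥ β)) (σ ^ 2 • (1 : Matrix (Fin n) (Fin n) ℝ))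

/-- The parameter of interest `θ = aᵀβ`. -/
def θ (β : Fin p → ℝ) : ℝ := D.a ⬝ᵥ β

/-- `τ = Cᵀβ - t`. -/
def τ (β : Fin p → ℝ) : Fin s → ℝ := D.Cᵀ *ᵥ β - D.t

/-- `XᵀX`. -/
def gram : Matrix (Fin p) (Fin p) ℝ := D.Xᵀ * D.X

/-- `v₁₁`, the variance of `Θ̂` divided by `σ²`. -/
def v₁₁ : ℝ := D.a ⬝ᵥ (D.gram⁻¹ *ᵥ D.a)

/-- `v₂₁`, the covariance of `τ̂` and `Θ̂` divided by `σ²`. -/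
def v₂₁ : Fin s → ℝ := D.Cᵀ *ᵥ (D.gram⁻¹ *ᵥ D.a)

/-- `V₂₂`, the covariance matrix of `τ̂` divided by `σ²`. -/
def V₂₂ : Matrix (Fin s) (Fin s) ℝ := D.Cᵀ * D.gram⁻¹ * D.C

/-! #### Statistics, as functions of the observed response `y` -/

variable (y : EuclideanSpace ℝ (Fin n))

/-- `R(β) = (Y - Xβ)ᵀ(Y - Xβ)`. -/
def R (β : Fin p → ℝ) : ℝ := (y.ofLp - D.X *ᵥ β) ⬝ᵥ (y.ofLp - D.X *ᵥ β)

/-- The least squares estimator `β̂`. -/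
def βhat : Fin p → ℝ := D.gram⁻¹ *ᵥ (D.Xᵀ *ᵥ y.ofLp)

/-- `τ̂ = Cᵀβ̂ - t`. -/
def τhat : Fin s → ℝ := D.τ (D.βhat y)

/-- `β*`, the minimizer of `R(β)` subject to `Cᵀβ - t = 0`. -/
def βstar : Fin p → ℝ := D.βhat y - D.gram⁻¹ *ᵥ (D.C *ᵥ (D.V₂₂⁻¹ *ᵥ D.τhat y))

theorem gram_posDef : D.gram.PosDef := by
  have := Matrix.PosDef.conjTranspose_mul_self D.X (Matrix.mulVec_injective_iff.2 D.linearIndependent_X)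
  simpa [gram] using this

theorem V_posDef : D.V₂₂.PosDef := by
  have := D.gram_posDef.inv.conjTranspose_mul_mul_same (Matrix.mulVec_injective_iff.2 D.linearIndependent_C)
  simpa [V₂₂] using this

theorem R_eq (β : Fin p → ℝ) :
    D.R y β = D.R y (D.βhat y) + (β - D.βhat y) ⬝ᵥ (D.gram *ᵥ (β - D.βhat y)) := by
  have h0 : D.Xᵀ *ᵥ (y.ofLp - D.X *ᵥ D.βhat y) = 0 := by
    have : D.gram *ᵥ D.βhat y = D.Xᵀ *ᵥ y.ofLp := by
      unfold βhat
      rw [mulVec_mulVec, Matrix.mul_nonsing_inv _ ((Matrix.isUnit_iff_isUnit_det _).1 D.gram_posDef.isUnit), one_mulVec]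
    rw [mulVec_sub, mulVec_mulVec, ← this]; simp [gram]
  have h1 : y.ofLp - D.X *ᵥ β = (y.ofLp - D.X *ᵥ D.βhat y) - D.X *ᵥ (β - D.βhat y) := by
    rw [mulVec_sub]; abel
  have h2 : ∀ v, (y.ofLp - D.X *ᵥ D.βhat y) ⬝ᵥ (D.X *ᵥ v) = 0 := by
    intro v
    rw [dotProduct_mulVec, ← mulVec_transpose, h0, zero_dotProduct]
  have h3 : ∀ v, (D.X *ᵥ v) ⬝ᵥ (D.X *ᵥ v) = v ⬝ᵥ (D.gram *ᵥ v) := by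
    intro v
    rw [gram, ← mulVec_mulVec, dotProduct_mulVec v, vecMul_transpose]
  have h4 := h2 (β - D.βhat y)
  have h5 := h3 (β - D.βhat y)
  unfold R
  rw [h1, ← h5]
  generalize y.ofLp - D.X *ᵥ D.βhat y = e at h4 ⊢
  generalize D.X *ᵥ (β - D.βhat y) = f at h4 ⊢
  rw [sub_dotProduct, dotProduct_sub, dotProduct_sub, dotProduct_comm f e, h4]
  ring

/-- `β̂` minimizes `R`. -/
theorem βhat_min (β : Fin p → ℝ) : D.R y (D.βhat y) ≤ D.R y β := by
  rw [D.R_eq y β]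
  have := D.gram_posDef.posSemidef.dotProduct_mulVec_nonneg (β - D.βhat y)
  rw [star_trivial] at this
  linarith

/-- `β*` satisfies the restriction `τ = 0`. -/
theorem τ_βstar : D.τ (D.βstar y) = 0 := by
  have : D.V₂₂ *ᵥ (D.V₂₂⁻¹ *ᵥ D.τhat y) = D.τhat y := by
    rw [mulVec_mulVec, Matrix.mul_nonsing_inv _ ((Matrix.isUnit_iff_isUnit_det _).1 D.V_posDef.isUnit), one_mulVec]
  have h : D.τ (D.βstar y) = D.τhat y - D.V₂₂ *ᵥ (D.V₂₂⁻¹ *ᵥ D.τhat y) := by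
    simp only [τhat, τ, βstar, V₂₂, mulVec_sub, mulVec_mulVec, Matrix.mul_assoc]
    abel
  rw [h, this, sub_self]

/-- `β*` minimizes `R` under the restriction. -/
theorem βstar_min (β : Fin p → ℝ) (h : D.τ β = 0) :
    D.R y (D.βstar y) ≤ D.R y β := by
  rw [D.R_eq y β, D.R_eq y (D.βstar y)]
  set e := D.βstar y - D.βhat y with he
  set f := β - D.βstar y with hf
  have h1 : β - D.βhat y = e + f := by rw [he, hf]; abel
  have hCf : D.Cᵀ *ᵥ f = 0 := by
    have := D.τ_βstar y
    simp only [τ] at this h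
    rw [hf, mulVec_sub, sub_eq_zero.1 h, sub_eq_zero.1 this, sub_self]
  have hge : D.gram *ᵥ e = D.C *ᵥ (-(D.V₂₂⁻¹ *ᵥ D.τhat y)) := by
    have : e = - (D.gram⁻¹ *ᵥ (D.C *ᵥ (D.V₂₂⁻¹ *ᵥ D.τhat y))) := by rw [he, βstar]; abel
    rw [this, mulVec_neg, mulVec_mulVec, Matrix.mul_nonsing_inv _ ((Matrix.isUnit_iff_isUnit_det _).1 D.gram_posDef.isUnit), one_mulVec, mulVec_neg]
  have hfe : f ⬝ᵥ (D.gram *ᵥ e) = 0 := by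
    rw [hge, dotProduct_mulVec, ← mulVec_transpose, hCf, zero_dotProduct]
  have hef : e ⬝ᵥ (D.gram *ᵥ f) = 0 := by
    rw [dotProduct_mulVec, ← mulVec_transpose, show D.gramᵀ = D.gram by simp [gram], dotProduct_comm, hfe]
  have := D.gram_posDef.posSemidef.dotProduct_mulVec_nonneg f
  rw [star_trivial] at this
  rw [h1, mulVec_add, dotProduct_add, add_dotProduct, add_dotProduct, hfe, hef]
  linarith

/-- `Σ̂ = √(R(β̂) / m)` with `m = n - p`. -/
def sigmaHat (m : ℕ) : ℝ := √(D.R y (D.βhat y) / m)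

/-- `Θ̂ = aᵀβ̂`. -/
def Θhat : ℝ := D.a ⬝ᵥ D.βhat y

/-- `Θ* = aᵀβ*`. -/
def Θstar : ℝ := D.a ⬝ᵥ D.βstar y

/-- The statistic `F` of the preliminary test of `τ = 0`. -/
def F (m : ℕ) : ℝ :=
  ((D.βhat y - D.βstar y) ⬝ᵥ (D.gram *ᵥ (D.βhat y - D.βstar y)) / s) / D.sigmaHat y m ^ 2

/-- The interval `I`, based on the full model. -/
def I (m : ℕ) (α : ℝ) : Set ℝ :=
  Set.Icc (D.Θhat y - tQuantile α m * √D.v₁₁ * D.sigmaHat y m)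
    (D.Θhat y + tQuantile α m * √D.v₁₁ * D.sigmaHat y m)

/-- The interval `J`, based on the model with `τ = 0`. -/
def J (m : ℕ) (α : ℝ) : Set ℝ :=
  Set.Icc
    (D.Θstar y - tQuantile α (m + s) * √(D.R y (D.βstar y) / (m + s))
      * √(D.v₁₁ - D.v₂₁ ⬝ᵥ (D.V₂₂⁻¹ *ᵥ D.v₂₁)))
    (D.Θstar y + tQuantile α (m + s) * √(D.R y (D.βstar y) / (m + s))
      * √(D.v₁₁ - D.v₂₁ ⬝ᵥ (D.V₂₂⁻¹ *ᵥ D.v₂₁)))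

open scoped Classical in
/-- The naive `1 - α` confidence interval for `θ` after the preliminary `F` test that rejects
`τ = 0` when `F > ℓ`. -/
def naiveCI (m : ℕ) (α ℓ : ℝ) : Set ℝ :=
  if D.F y m > ℓ then D.I y m α else D.J y m α

/-! #### Probabilities and parameters -/

/-- The coverage probability of the naive confidence interval. -/
def coverage (m : ℕ) (α ℓ : ℝ) (β : Fin p → ℝ) (σ : ℝ) : ℝ :=
  (D.law β σ).real {y | D.θ β ∈ D.naiveCI y m α ℓ}

/-- `P(θ ∈ I, F > ℓ)`. -/
def probI (m : ℕ) (α ℓ : ℝ) (β : Fin p → ℝ) (σ : ℝ) : ℝ :=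
  (D.law β σ).real {y | D.θ β ∈ D.I y m α ∧ D.F y m > ℓ}

/-- `P(θ ∈ J, F ≤ ℓ)`. -/
def probJ (m : ℕ) (α ℓ : ℝ) (β : Fin p → ℝ) (σ : ℝ) : ℝ :=
  (D.law β σ).real {y | D.θ β ∈ D.J y m α ∧ D.F y m ≤ ℓ}

/-- `W = Σ̂ / σ`. -/
def W (m : ℕ) (σ : ℝ) : ℝ := D.sigmaHat y m / σ

/-- The density `f_W` of `W`. -/
def fW (m : ℕ) (β : Fin p → ℝ) (σ : ℝ) : ℝ → ℝ :=
  density ((D.law β σ).map fun y => D.W y m σ)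

/-- `V₂₂^{-1/2}`, the inverse of the positive definite square root of `V₂₂`. -/
def V₂₂invSqrt : Matrix (Fin s) (Fin s) ℝ := (CFC.sqrt D.V₂₂)⁻¹

/-- `b = v₁₁^{-1/2} V₂₂^{-1/2} v₂₁`. -/
def b : EuclideanSpace ℝ (Fin s) := WithLp.toLp 2 ((√D.v₁₁)⁻¹ • (D.V₂₂invSqrt *ᵥ D.v₂₁))

/-- `γ = (1/σ) V₂₂^{-1/2} τ`. -/
def γ (β : Fin p → ℝ) (σ : ℝ) : EuclideanSpace ℝ (Fin s) :=
  WithLp.toLp 2 (σ⁻¹ • (D.V₂₂invSqrt *ᵥ D.τ β))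

open scoped Classical in
/-- `ψ = u_bᵀ u_γ`, where `u_b = b / ‖b‖` and `u_γ = γ / ‖γ‖`; by convention `ψ = 1` when `γ = 0`.
When `b = 0` and `γ ≠ 0` this gives `ψ = 0`; in that case `ψ` enters the coverage probability
only through products with `‖b‖ = 0`. -/
def ψ (β : Fin p → ℝ) (σ : ℝ) : ℝ :=
  if D.γ β σ = 0 then 1
  else inner ℝ (‖D.b‖⁻¹ • D.b) (‖D.γ β σ‖⁻¹ • D.γ β σ)

end Regression

end

/-! Write Y = Xβ + σε with ε standard normal. Everything depends on three functions of ε: the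
standardized error h of τ̂ (`errTau`), W = Σ̂/σ, and Z, the inner product of ε with `residDir`, the
part of the noise direction of Θ̂ orthogonal to that of τ̂. The rows of `errMatrix` are orthonormal,
`residDir` is orthogonal to them with squared norm 1 - ‖b‖², and all of these lie in the column
space of X, while the residuals lie in its orthogonal complement. Hence h, W, Z are independent, h
is standard normal in dimension s, mW² is χ²_m and Z ∼ N(0, 1 - ‖b‖²)
(`stdGaussian_map_statistics`).

Algebra gives Θ̂ - θ = σ√v₁₁ (Z + bᵀh), Θ* - θ = σ√v₁₁ (Z - bᵀγ), R(β*) = σ²(mW² + ‖γ + h‖²) and,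
for W > 0, F = ‖γ + h‖²/(sW²). So each event confines Z to an interval determined by h and W, and
integrating Z out produces i and j.

On F ≤ ℓ only ‖γ + h‖² survives of h, and it is noncentral χ². On F > ℓ both ‖γ + h‖ and bᵀh matter.
A rotation puts γ on the first axis and b in the span of the first two (`exists_rotation`), so the
integrand depends on h₀, h₁ and ‖h‖ only, and on the problem only through ‖b‖, ‖γ‖, ψ
(`probI_canonical`, `probJ_canonical`). This already yields the last claim.

The explicit integrals come from polar coordinates, one axis at a time: a normal variable paired
with an independent radial one has independent radius and angle, the angular density being a power
of the sine (`gaussianReal_prod_radialLaw`). Applied once or twice, this gives the joint law of ‖h‖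
and the leading coordinates. -/

/-! ### Sine integrals, null sets and polar coordinates -/

theorem integral_sin_pow_eq_beta (k : ℕ) :
    ∫ x in (0 : ℝ)..Real.pi, Real.sin x ^ k = beta (1 / 2) (((k : ℝ) + 1) / 2) := by
  -- Passing from k to k + 2 multiplies both sides by (k + 1)/(k + 2): on the left by the reduction
  -- formula, on the right by Γ(x + 1) = xΓ(x).
  induction k using Nat.twoStepInduction with
  | zero =>
    simp [beta]
    norm_num [Real.mul_self_sqrt Real.pi_pos.le, Real.Gamma_one_half_eq]
  | one =>
    have h : Real.Gamma (1 / 2 + 1) = 1 / 2 * Real.Gamma (1 / 2) :=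
      Real.Gamma_add_one (by norm_num)
    have h0 : Real.Gamma (1 / 2) ≠ 0 := (Real.Gamma_pos_of_pos (by norm_num)).ne'
    have h1 : (((1 : ℕ) : ℝ) + 1) / 2 = 1 := by norm_num
    rw [h1]
    simp only [pow_one, integral_sin, beta, h, Real.Gamma_one]
    field_simp
    simp
    norm_num
  | more k ih _ =>
    rw [integral_sin_pow, ih]
    have h1 : (((k + 2 : ℕ) : ℝ) + 1) / 2 = ((k : ℝ) + 1) / 2 + 1 := by push_cast; ring
    have h2 : (1 : ℝ) / 2 + (((k : ℝ) + 1) / 2 + 1) = (1 / 2 + ((k : ℝ) + 1) / 2) + 1 := by ring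
    have hp : (0 : ℝ) < ((k : ℝ) + 1) / 2 := by positivity
    have hp2 : (0 : ℝ) < 1 / 2 + ((k : ℝ) + 1) / 2 := by positivity
    have h3 := (Real.Gamma_pos_of_pos hp2).ne'
    rw [h1]
    simp only [beta, h2]
    rw [Real.Gamma_add_one hp.ne', Real.Gamma_add_one hp2.ne']
    have : (1 : ℝ) / 2 + ((k : ℝ) + 1) / 2 = (k + 2) / 2 := by ring
    simp only [Real.sin_zero, Real.sin_pi, this] at h3 ⊢
    have hk : (k : ℝ) + 2 ≠ 0 := by positivity
    field_simp
    simp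

/-- Affine substitution on the unit interval. -/
theorem lintegral_Ioo_affine {a : ℝ} (ha : 0 < a) (b : ℝ) (g : ℝ → ℝ≥0∞) :
    ∫⁻ x in Set.Ioo b (a + b), g x =
      ∫⁻ t in Set.Ioo (0 : ℝ) 1, ENNReal.ofReal a * g (a * t + b) := by
  have himg : (fun t : ℝ => a * t + b) '' Set.Ioo 0 1 = Set.Ioo b (a + b) := by
    rw [Set.image_affine_Ioo ha]; simp
  rw [← himg, lintegral_image_eq_lintegral_abs_deriv_mul measurableSet_Ioo
    (f' := fun _ => a) (fun x _ => ?_) (fun x _ y _ h => ?_)]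
  · simp [abs_of_pos ha]
  · simpa using (((hasDerivAt_id x).const_mul a).add_const b).hasDerivWithinAt
  · have : a * x + b = a * y + b := h
    exact mul_left_cancel₀ ha.ne' (by linarith)

/-- The preimage of a Lebesgue null set under a translated square is null. -/
theorem volume_preimage_sq_eq_zero {N : Set ℝ} (hN : volume N = 0) (a c : ℝ) :
    volume ((fun x : ℝ => (x + a) ^ 2 + c) ⁻¹' N) = 0 := by
  have hN' : volume ((fun y : ℝ => y - c) '' N ∩ Set.Ioi 0) = 0 := by
    refine measure_mono_null Set.inter_subset_left ?_
    exact addHaar_image_eq_zero_of_differentiableOn_of_addHaar_eq_zero volume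
      (by fun_prop) hN
  -- For e = ±1 these are the two inverse branches. They are differentiable away from the branch
  -- point, so they preserve null sets; the branch point x = -a is added as a singleton.
  have key : ∀ e : ℝ, volume ((fun y : ℝ => e * √y - a) ''
      ((fun y : ℝ => y - c) '' N ∩ Set.Ioi 0)) = 0 := by
    intro e
    refine addHaar_image_eq_zero_of_differentiableOn_of_addHaar_eq_zero volume ?_ hN'
    intro y hy
    have : DifferentiableAt ℝ Real.sqrt y := (Real.hasDerivAt_sqrt (ne_of_gt hy.2)).differentiableAt
    exact ((this.const_mul e).sub_const a).differentiableWithinAt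
  refine measure_mono_null (fun x hx => ?_)
    (measure_union_null (measure_union_null (key 1) (key (-1))) (Real.volume_singleton (a := -a)))
  have hx' : (x + a) ^ 2 + c ∈ N := hx
  by_cases h0 : x + a = 0
  · right; simp only [Set.mem_singleton_iff]; linarith
  left
  have hmem : (x + a) ^ 2 ∈ (fun y : ℝ => y - c) '' N ∩ Set.Ioi 0 :=
    ⟨⟨_, hx', by simp⟩, show 0 < (x + a) ^ 2 by positivity⟩
  rcases lt_or_gt_of_ne h0 with h | h
  · right
    exact ⟨_, hmem, by simp [Real.sqrt_sq_eq_abs, abs_of_neg h]⟩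
  · left
    exact ⟨_, hmem, by simp [Real.sqrt_sq_eq_abs, abs_of_pos h]⟩

/-- On the positive half line the map has the smooth inverse y ↦ c y², so the preimage lies in a
differentiable image of N. -/
theorem volume_preimage_sqrt_div_inter_Ioi_eq_zero {N : Set ℝ} (hN : volume N = 0) {c : ℝ}
    (hc : 0 < c) : volume ((fun x : ℝ => √(x / c)) ⁻¹' N ∩ Set.Ioi 0) = 0 := by
  refine measure_mono_null (fun x hx => ?_)
    (addHaar_image_eq_zero_of_differentiableOn_of_addHaar_eq_zero volume
      (f := fun y : ℝ => c * y ^ 2) (by fun_prop) hN)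
  refine ⟨_, hx.1, ?_⟩
  have : 0 ≤ x / c := div_nonneg (le_of_lt hx.2) hc.le
  simp only [Real.sq_sqrt this]
  field_simp

/-- Polar coordinates in the upper half plane, with the angle scaled to the unit interval. -/
theorem lintegral_upper_half_plane_polar (f : ℝ × ℝ → ℝ≥0∞) (hf : Measurable f) :
    ∫⁻ p in Set.univ ×ˢ Set.Ioi (0 : ℝ), f p =
      ∫⁻ p in Set.Ioi (0 : ℝ) ×ˢ Set.Ioo (0 : ℝ) 1,
        ENNReal.ofReal p.1 * ENNReal.ofReal Real.pi *
          f (p.1 * Real.cos (Real.pi * p.2), p.1 * Real.sin (Real.pi * p.2)) := by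
  have hS : MeasurableSet (Set.univ ×ˢ Set.Ioi (0 : ℝ) : Set (ℝ × ℝ)) :=
    MeasurableSet.univ.prod measurableSet_Ioi
  rw [← lintegral_indicator hS, ← lintegral_comp_polarCoord_symm]
  -- Among angles in (-π, π), the sine is positive exactly on (0, π), so the indicator of the half
  -- plane cuts the angular range down to that interval.
  have h1 : ∀ p ∈ polarCoord.target, ENNReal.ofReal p.1 •
      (Set.univ ×ˢ Set.Ioi (0 : ℝ)).indicator f (polarCoord.symm p) =
      (Set.Ioi (0 : ℝ) ×ˢ Set.Ioo 0 Real.pi).indicator (fun p => ENNReal.ofReal p.1 *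
        f (p.1 * Real.cos p.2, p.1 * Real.sin p.2)) p := by
    rintro ⟨r, φ⟩ ⟨hr, hφ⟩
    have hr' : 0 < r := hr
    have hiff : (polarCoord.symm (r, φ) ∈ (Set.univ ×ˢ Set.Ioi (0 : ℝ) : Set (ℝ × ℝ))) ↔
        (r, φ) ∈ Set.Ioi (0 : ℝ) ×ˢ Set.Ioo 0 Real.pi := by
      simp only [polarCoord_symm_apply, Set.mem_prod, Set.mem_univ, true_and, Set.mem_Ioi,
        Set.mem_Ioo, mul_pos_iff_of_pos_left hr', hr']
      refine ⟨fun h => ⟨?_, hφ.2⟩, fun h => Real.sin_pos_of_pos_of_lt_pi h.1 h.2⟩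
      by_contra! h'
      exact absurd (Real.sin_nonpos_of_nonpos_of_neg_pi_le h' hφ.1.le) (not_le.2 h)
    by_cases h : (r, φ) ∈ Set.Ioi (0 : ℝ) ×ˢ Set.Ioo 0 Real.pi
    · rw [Set.indicator_of_mem h, Set.indicator_of_mem (hiff.2 h)]
      simp
    · rw [Set.indicator_of_notMem h, Set.indicator_of_notMem (fun h' => h (hiff.1 h'))]
      simp
  have hS' : MeasurableSet (Set.Ioi (0 : ℝ) ×ˢ Set.Ioo 0 Real.pi) :=
    measurableSet_Ioi.prod measurableSet_Ioo
  rw [setLIntegral_congr_fun polarCoord.open_target.measurableSet h1,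
    setLIntegral_indicator hS', Set.inter_eq_left.2]
  · rw [Measure.volume_eq_prod, ← Measure.prod_restrict, ← Measure.prod_restrict,
      lintegral_prod _ (by fun_prop), lintegral_prod _ (by fun_prop)]
    refine lintegral_congr fun r => ?_
    have := lintegral_Ioo_affine Real.pi_pos 0
      (fun φ => ENNReal.ofReal r * f (r * Real.cos φ, r * Real.sin φ))
    simp only [add_zero] at this
    rw [this]
    refine lintegral_congr fun t => ?_
    ring
  · rintro ⟨r, φ⟩ ⟨hr, hφ⟩
    exact ⟨hr, by linarith [hφ.1, Real.pi_pos], hφ.2⟩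

/-- Polar coordinates in the plane, with the angle scaled to the unit interval. -/
theorem lintegral_plane_polar (f : ℝ × ℝ → ℝ≥0∞) (hf : Measurable f) :
    ∫⁻ p, f p =
      ∫⁻ p in Set.Ioi (0 : ℝ) ×ˢ Set.Ioo (0 : ℝ) 1,
        ENNReal.ofReal p.1 * ENNReal.ofReal (2 * Real.pi) *
          f (p.1 * Real.cos (2 * Real.pi * p.2), p.1 * Real.sin (2 * Real.pi * p.2)) := by
  -- Replacing p by -p turns the angle by π. This cancels the shift in φ = 2πt - π, which maps (0,
  -- 1) onto (-π, π).
  rw [← lintegral_neg_eq_self, ← lintegral_comp_polarCoord_symm]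
  change ∫⁻ p in Set.Ioi (0 : ℝ) ×ˢ Set.Ioo (-Real.pi) Real.pi, ENNReal.ofReal p.1 *
    f (-polarCoord.symm p) = _
  simp only [polarCoord_symm_apply, Prod.neg_mk]
  rw [Measure.volume_eq_prod, ← Measure.prod_restrict, ← Measure.prod_restrict,
      lintegral_prod _ (by fun_prop), lintegral_prod _ (by fun_prop)]
  refine lintegral_congr fun r => ?_
  have := lintegral_Ioo_affine Real.two_pi_pos (-Real.pi)
      (fun φ => ENNReal.ofReal r * f (-(r * Real.cos φ), -(r * Real.sin φ)))
  rw [show 2 * Real.pi + -Real.pi = Real.pi by ring] at this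
  rw [this]
  refine lintegral_congr fun t => ?_
  rw [← sub_eq_add_neg, Real.cos_sub_pi, Real.sin_sub_pi]
  simp only [mul_neg, neg_neg]
  ring

/-! ### Radial and angular laws -/

noncomputable section

/-- The law with density `f_{T₁}`. -/
def angleLaw (s : ℕ) : Measure ℝ := volume.withDensity fun t => ENNReal.ofReal (fT₁ s t)

/-- The measure on the positive half line with density `c r^k exp(-r²/2)`. -/
def radialLaw (c : ℝ) (k : ℕ) : Measure ℝ :=
  (volume.restrict (Set.Ioi 0)).withDensity fun r =>
    ENNReal.ofReal (c * r ^ k * Real.exp (-r ^ 2 / 2))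

theorem measurable_fT₁ (s : ℕ) : Measurable (fT₁ s) :=
  Measurable.ite (measurableSet_Icc (a := (0 : ℝ)) (b := 1)) (by fun_prop) measurable_const

theorem angleLaw_eq (k : ℕ) :
    angleLaw (k + 2) = (volume.restrict (Set.Ioo 0 1)).withDensity fun t =>
      ENNReal.ofReal (Real.pi / beta (1 / 2) (((k : ℝ) + 1) / 2) * Real.sin (Real.pi * t) ^ k) := by
  have h : (fun t => ENNReal.ofReal (fT₁ (k + 2) t)) = (Set.Icc (0 : ℝ) 1).indicator fun t =>
      ENNReal.ofReal (Real.pi / beta (1 / 2) (((k : ℝ) + 1) / 2) * Real.sin (Real.pi * t) ^ k) := by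
    ext t
    by_cases ht : t ∈ Set.Icc (0 : ℝ) 1
    · rw [Set.indicator_of_mem ht, fT₁, if_pos (show 0 ≤ t ∧ t ≤ 1 from ht)]
      have : (((k + 2 : ℕ) : ℝ) - 1) / 2 = ((k : ℝ) + 1) / 2 := by push_cast; ring
      rw [this]; simp
    · rw [Set.indicator_of_notMem ht, fT₁, if_neg (show ¬(0 ≤ t ∧ t ≤ 1) from ht)]; simp
  rw [angleLaw, h, withDensity_indicator measurableSet_Icc, Measure.restrict_congr_set Ioo_ae_eq_Icc]

/-- The normalizing constant is B(1/2, 1/2) = π and the sine has exponent zero, so the density is 1.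
The uniform angle of the plane thus fits the same family. -/
theorem angleLaw_two : angleLaw 2 = volume.restrict (Set.Ioo 0 1) := by
  rw [show 2 = 0 + 2 by rfl, angleLaw_eq]
  have h := integral_sin_pow_eq_beta 0
  simp only [pow_zero, intervalIntegral.integral_const, sub_zero, smul_eq_mul, mul_one] at h
  simp only [← h, pow_zero, mul_one, div_self Real.pi_ne_zero, ENNReal.ofReal_one]
  exact withDensity_one

theorem beta_half_pos (k : ℕ) : 0 < beta (1 / 2) (((k : ℝ) + 1) / 2) :=
  beta_pos (by norm_num) (by positivity)

theorem isProbabilityMeasure_angleLaw (k : ℕ) : IsProbabilityMeasure (angleLaw (k + 2)) := by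
  constructor
  rw [angleLaw_eq, withDensity_apply _ MeasurableSet.univ, Measure.restrict_univ]
  have hb := beta_half_pos k
  have h := lintegral_Ioo_affine Real.pi_pos 0 (fun φ => ENNReal.ofReal
    ((beta (1 / 2) (((k : ℝ) + 1) / 2))⁻¹ * Real.sin φ ^ k))
  simp only [add_zero] at h
  have h2 : ∀ t, ENNReal.ofReal (Real.pi / beta (1 / 2) (((k : ℝ) + 1) / 2) *
      Real.sin (Real.pi * t) ^ k) = ENNReal.ofReal Real.pi *
      ENNReal.ofReal ((beta (1 / 2) (((k : ℝ) + 1) / 2))⁻¹ * Real.sin (Real.pi * t) ^ k) := by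
    intro t
    rw [← ENNReal.ofReal_mul Real.pi_pos.le, div_eq_mul_inv, mul_assoc]
  simp only [h2]
  rw [← h, ← ofReal_integral_eq_lintegral_ofReal, ← integral_Ioc_eq_integral_Ioo,
    ← intervalIntegral.integral_of_le Real.pi_pos.le, intervalIntegral.integral_const_mul,
    integral_sin_pow_eq_beta, inv_mul_cancel₀ hb.ne', ENNReal.ofReal_one]
  · refine (Continuous.integrableOn_Icc (by fun_prop)).mono_set Set.Ioo_subset_Icc_self
  · filter_upwards [ae_restrict_mem measurableSet_Ioo] with x hx
    have := Real.sin_pos_of_pos_of_lt_pi hx.1 hx.2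
    simp only [Pi.zero_apply]
    positivity

theorem gaussianPDF_zero_one (x : ℝ) :
    gaussianPDF 0 1 x = ENNReal.ofReal ((√(2 * Real.pi))⁻¹ * Real.exp (-x ^ 2 / 2)) := by
  simp [gaussianPDF, gaussianPDFReal]

theorem sfinite_radialLaw (c : ℝ) (k : ℕ) : SFinite (radialLaw c k) := by
  unfold radialLaw; infer_instance

theorem ae_pos_radialLaw (c : ℝ) (k : ℕ) : ∀ᵐ r ∂radialLaw c k, 0 < r :=
  (withDensity_absolutelyContinuous _ _).ae_le (ae_restrict_mem measurableSet_Ioi)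

/-- A standard normal variable and an independent radial one, in polar coordinates. -/
theorem gaussianReal_prod_radialLaw {c : ℝ} (hc : 0 ≤ c) (k : ℕ) :
    (gaussianReal 0 1).prod (radialLaw c k) =
      ((radialLaw (c * (√(2 * Real.pi))⁻¹ * beta (1 / 2) (((k : ℝ) + 1) / 2)) (k + 1)).prod
        (angleLaw (k + 2))).map
        fun p => (p.1 * Real.cos (Real.pi * p.2), p.1 * Real.sin (Real.pi * p.2)) := by
  have hb := beta_half_pos k
  refine Measure.ext_of_lintegral _ fun f hf => ?_
  rw [lintegral_map hf (by fun_prop), angleLaw_eq, gaussianReal_of_var_ne_zero _ one_ne_zero,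
    radialLaw, radialLaw, prod_withDensity (by fun_prop) (by fun_prop),
    prod_withDensity (by fun_prop) (by fun_prop), lintegral_withDensity_eq_lintegral_mul _
    (by fun_prop) hf, lintegral_withDensity_eq_lintegral_mul _ (by fun_prop) (by fun_prop)]
  nth_rw 1 [← Measure.restrict_univ (μ := (volume : Measure ℝ))]
  rw [Measure.prod_restrict, Measure.prod_restrict, ← Measure.volume_eq_prod,
    lintegral_upper_half_plane_polar _ (by fun_prop)]
  refine setLIntegral_congr_fun (measurableSet_Ioi.prod measurableSet_Ioo) fun p hp => ?_
  obtain ⟨r, t⟩ := p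
  have hr : 0 < r := hp.1
  have ht : 0 < t ∧ t < 1 := hp.2
  have hsin : 0 < Real.sin (Real.pi * t) := Real.sin_pos_of_pos_of_lt_pi
    (mul_pos Real.pi_pos ht.1) (by nlinarith [Real.pi_pos])
  simp only [Pi.mul_apply, gaussianPDF_zero_one]
  rw [← mul_assoc]
  congr 1
  have h2 : 0 < √(2 * Real.pi) := Real.sqrt_pos.2 (by positivity)
  have hπ := Real.pi_pos
  rw [← ENNReal.ofReal_mul hr.le, ← ENNReal.ofReal_mul (by positivity),
    ← ENNReal.ofReal_mul (by positivity), ← ENNReal.ofReal_mul (by positivity)]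
  congr 1
  have he : Real.exp (-r ^ 2 / 2) = Real.exp (-(r * Real.cos (Real.pi * t)) ^ 2 / 2) *
      Real.exp (-(r * Real.sin (Real.pi * t)) ^ 2 / 2) := by
    rw [← Real.exp_add]
    congr 1
    linear_combination r ^ 2 / 2 * Real.sin_sq_add_cos_sq (Real.pi * t)
  rw [he]
  field_simp
  ring

/-- Here both coordinates take either sign, so the angle runs over the full circle and is uniform.
In the previous lemma the second variable is positive and the angle stays in the half circle. -/
theorem gaussianReal_prod_self_polar :
    (gaussianReal 0 1).prod (gaussianReal 0 1) = ((radialLaw 1 1).prod (angleLaw 2)).map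
      fun p => (p.1 * Real.cos (2 * Real.pi * p.2), p.1 * Real.sin (2 * Real.pi * p.2)) := by
  refine Measure.ext_of_lintegral _ fun f hf => ?_
  rw [lintegral_map hf (by fun_prop), angleLaw_two, gaussianReal_of_var_ne_zero _ one_ne_zero,
    radialLaw, ← withDensity_one (μ := volume.restrict (Set.Ioo (0 : ℝ) 1)),
    prod_withDensity (by fun_prop) (by fun_prop),
    prod_withDensity (by fun_prop) (by fun_prop), lintegral_withDensity_eq_lintegral_mul _
    (by fun_prop) hf, lintegral_withDensity_eq_lintegral_mul _ (by fun_prop) (by fun_prop),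
    Measure.prod_restrict, ← Measure.volume_eq_prod, lintegral_plane_polar _ (by fun_prop)]
  refine setLIntegral_congr_fun (measurableSet_Ioi.prod measurableSet_Ioo) fun p hp => ?_
  obtain ⟨r, t⟩ := p
  have hr : 0 < r := hp.1
  simp only [Pi.mul_apply, gaussianPDF_zero_one, Pi.one_apply, mul_one]
  rw [← mul_assoc]
  congr 1
  have hπ := Real.pi_pos
  have h2 : 0 < √(2 * Real.pi) := Real.sqrt_pos.2 (by positivity)
  rw [← ENNReal.ofReal_mul hr.le, ← ENNReal.ofReal_mul (by positivity),
    ← ENNReal.ofReal_mul (by positivity)]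
  congr 1
  have he : Real.exp (-r ^ 2 / 2) = Real.exp (-(r * Real.cos (2 * Real.pi * t)) ^ 2 / 2) *
      Real.exp (-(r * Real.sin (2 * Real.pi * t)) ^ 2 / 2) := by
    rw [← Real.exp_add]
    congr 1
    linear_combination r ^ 2 / 2 * Real.sin_sq_add_cos_sq (2 * Real.pi * t)
  have h3 : √(2 * Real.pi) ^ 2 = 2 * Real.pi := Real.sq_sqrt (by positivity)
  rw [he]
  field_simp
  rw [h3]

/-! ### Norm and leading coordinates of a standard Gaussian vector -/

/-- The first coordinate of a standard Gaussian vector is independent of the others. -/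
theorem stdGaussian_map_cons (k : ℕ) :
    (stdGaussian (EuclideanSpace ℝ (Fin (k + 1)))).map
      (fun h => (h 0, WithLp.toLp 2 fun i : Fin k => h i.succ)) =
      (gaussianReal 0 1).prod (stdGaussian (EuclideanSpace ℝ (Fin k))) := by
  have h1 := (measurePreserving_piFinSuccAbove (fun _ : Fin (k + 1) => gaussianReal 0 1) 0).map_eq
  rw [← map_pi_eq_stdGaussian, ← map_pi_eq_stdGaussian, Measure.map_map (by fun_prop) (by fun_prop)]
  have : IsProbabilityMeasure ((Measure.pi fun _ : Fin k => gaussianReal 0 1).map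
      (WithLp.toLp 2)) := Measure.isProbabilityMeasure_map (by fun_prop)
  have h2 := Measure.map_prod_map (gaussianReal 0 1) (Measure.pi fun _ : Fin k => gaussianReal 0 1)
    measurable_id (WithLp.measurable_toLp 2 (Fin k → ℝ))
  rw [Measure.map_id] at h2
  rw [h2, ← h1, Measure.map_map (by fun_prop) (by fun_prop)]
  rfl

theorem chiLaw_eq_map_norm (k : ℕ) :
    chiLaw k = (stdGaussian (EuclideanSpace ℝ (Fin k))).map fun h => ‖h‖ := by
  rw [chiLaw, chiSquared, Measure.map_map (by fun_prop) (by fun_prop)]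
  congr 1
  ext h
  simp [EuclideanSpace.norm_eq]

theorem isProbabilityMeasure_chiLaw (k : ℕ) : IsProbabilityMeasure (chiLaw k) := by
  rw [chiLaw_eq_map_norm]
  exact Measure.isProbabilityMeasure_map (by fun_prop)

theorem norm_eq_sqrt_cons {k : ℕ} (h : EuclideanSpace ℝ (Fin (k + 1))) :
    ‖h‖ = √(h 0 ^ 2 + ‖(WithLp.toLp 2 fun i : Fin k => h i.succ : EuclideanSpace ℝ (Fin k))‖ ^ 2) := by
  rw [EuclideanSpace.norm_eq, EuclideanSpace.real_norm_sq_eq, Fin.sum_univ_succ]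
  simp

theorem stdGaussian_map_head_norm_tail (k : ℕ) :
    (stdGaussian (EuclideanSpace ℝ (Fin (k + 1)))).map
      (fun h => (h 0, ‖(WithLp.toLp 2 fun i : Fin k => h i.succ : EuclideanSpace ℝ (Fin k))‖)) =
      (gaussianReal 0 1).prod (chiLaw k) := by
  have h2 := Measure.map_prod_map (gaussianReal 0 1) (stdGaussian (EuclideanSpace ℝ (Fin k)))
    measurable_id (measurable_norm (α := EuclideanSpace ℝ (Fin k)))
  rw [Measure.map_id] at h2
  rw [chiLaw_eq_map_norm, h2, ← stdGaussian_map_cons, Measure.map_map (by fun_prop) (by fun_prop)]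
  rfl

theorem chiLaw_succ (k : ℕ) :
    chiLaw (k + 1) = ((gaussianReal 0 1).prod (chiLaw k)).map fun p => √(p.1 ^ 2 + p.2 ^ 2) := by
  rw [← stdGaussian_map_head_norm_tail, Measure.map_map (by fun_prop) (by fun_prop),
    chiLaw_eq_map_norm]
  congr 1
  ext h
  exact norm_eq_sqrt_cons h

theorem stdGaussian_fin_two :
    (stdGaussian (EuclideanSpace ℝ (Fin 2))).map (fun h => (h 0, h 1)) =
      (gaussianReal 0 1).prod (gaussianReal 0 1) := by
  have h1 := (measurePreserving_finTwoArrow (gaussianReal 0 1)).map_eq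
  rw [← map_pi_eq_stdGaussian, Measure.map_map (by fun_prop) (by fun_prop), ← h1]
  rfl

/-- Since r > 0 almost surely, √(r²cos² + r²sin²) is r itself. Taking norms in a polar factorization
therefore identifies its radial factor. -/
theorem map_polar_radius {μ ν : Measure ℝ} [SFinite μ] [IsProbabilityMeasure ν]
    (hμ : ∀ᵐ r ∂μ, 0 < r) (a : ℝ) :
    ((μ.prod ν).map fun p => (p.1 * Real.cos (a * p.2), p.1 * Real.sin (a * p.2))).map
      (fun p => √(p.1 ^ 2 + p.2 ^ 2)) = μ := by
  rw [Measure.map_map (by fun_prop) (by fun_prop)]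
  have h := (Measure.quasiMeasurePreserving_fst (μ := μ) (ν := ν)).ae hμ
  have h2 : ((fun p : ℝ × ℝ => √(p.1 ^ 2 + p.2 ^ 2)) ∘ fun p : ℝ × ℝ =>
      (p.1 * Real.cos (a * p.2), p.1 * Real.sin (a * p.2))) =ᵐ[μ.prod ν] Prod.fst := by
    filter_upwards [h] with p hp
    have : (p.1 * Real.cos (a * p.2)) ^ 2 + (p.1 * Real.sin (a * p.2)) ^ 2 = p.1 ^ 2 := by
      linear_combination p.1 ^ 2 * Real.sin_sq_add_cos_sq (a * p.2)
    simp [this, Real.sqrt_sq hp.le]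
  rw [Measure.map_congr h2]
  exact (measurePreserving_fst (μ := μ) (ν := ν)).map_eq

theorem chiLaw_two : chiLaw 2 = radialLaw 1 1 := by
  have := isProbabilityMeasure_angleLaw 0
  have := sfinite_radialLaw 1 1
  rw [← map_polar_radius (ν := angleLaw 2) (ae_pos_radialLaw 1 1) (2 * Real.pi),
    ← gaussianReal_prod_self_polar, ← stdGaussian_fin_two,
    Measure.map_map (by fun_prop) (by fun_prop), chiLaw_eq_map_norm]
  congr 1
  ext h
  simp [EuclideanSpace.norm_eq]

/-- Induction from the plane: each new coordinate raises the power of r by one. The constant may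
stay implicit, because only the shape of the density is needed to apply
`gaussianReal_prod_radialLaw`. -/
theorem exists_chiLaw_eq_radialLaw (k : ℕ) :
    ∃ c : ℝ, 0 ≤ c ∧ chiLaw (k + 2) = radialLaw c (k + 1) := by
  induction k with
  | zero => exact ⟨1, zero_le_one, chiLaw_two⟩
  | succ k ih =>
    obtain ⟨c, hc, h⟩ := ih
    have hb := beta_half_pos (k + 1)
    refine ⟨c * (√(2 * Real.pi))⁻¹ * beta (1 / 2) ((((k + 1 : ℕ) : ℝ) + 1) / 2), by positivity, ?_⟩
    have := isProbabilityMeasure_angleLaw (k + 1)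
    have := sfinite_radialLaw (c * (√(2 * Real.pi))⁻¹ *
      beta (1 / 2) ((((k + 1 : ℕ) : ℝ) + 1) / 2)) (k + 1 + 1)
    rw [chiLaw_succ, h, gaussianReal_prod_radialLaw hc, map_polar_radius (ae_pos_radialLaw _ _)]

theorem ae_pos_chiLaw (k : ℕ) : ∀ᵐ r ∂chiLaw (k + 2), 0 < r := by
  obtain ⟨c, -, h⟩ := exists_chiLaw_eq_radialLaw k
  rw [h]
  exact ae_pos_radialLaw _ _

/-- The radial factor is the law of √(x² + y²), which is the χ law in one dimension more; this
absorbs the implicit constants. -/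
theorem gaussianReal_prod_chiLaw (k : ℕ) :
    (gaussianReal 0 1).prod (chiLaw (k + 2)) = ((chiLaw (k + 3)).prod (angleLaw (k + 3))).map
      fun p => (p.1 * Real.cos (Real.pi * p.2), p.1 * Real.sin (Real.pi * p.2)) := by
  obtain ⟨c, hc, h⟩ := exists_chiLaw_eq_radialLaw k
  have := isProbabilityMeasure_angleLaw (k + 1)
  have := sfinite_radialLaw (c * (√(2 * Real.pi))⁻¹ *
    beta (1 / 2) ((((k + 1 : ℕ) : ℝ) + 1) / 2)) (k + 1 + 1)
  have h3 : chiLaw (k + 3) = radialLaw (c * (√(2 * Real.pi))⁻¹ *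
      beta (1 / 2) ((((k + 1 : ℕ) : ℝ) + 1) / 2)) (k + 1 + 1) := by
    rw [chiLaw_succ, h, gaussianReal_prod_radialLaw hc, map_polar_radius (ae_pos_radialLaw _ _)]
  rw [h, gaussianReal_prod_radialLaw hc, h3]

/-- The law of the two coordinates of a planar standard Gaussian vector in polar coordinates. -/
theorem stdGaussian_fin_two_polar :
    (stdGaussian (EuclideanSpace ℝ (Fin 2))).map (fun h => (h 0, h 1)) =
      ((chiLaw 2).prod (angleLaw 2)).map
        fun p => (p.1 * Real.cos (2 * Real.pi * p.2), p.1 * Real.sin (2 * Real.pi * p.2)) := by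
  rw [stdGaussian_fin_two, gaussianReal_prod_self_polar, chiLaw_two]

/-- The cosine of the angle with a fixed axis, in dimension `s`, as a function of the angle
variable in the unit interval. -/
def axisCos (s : ℕ) (t : ℝ) : ℝ :=
  if s = 2 then Real.cos (2 * Real.pi * t) else Real.cos (Real.pi * t)

theorem measurable_axisCos (s : ℕ) : Measurable (axisCos s) := by
  unfold axisCos
  split_ifs <;> fun_prop

/-- The first coordinate is the norm times the cosine of the angle with its axis. In the plane the
rest is one signed coordinate, hence a full circle; in higher dimension it is replaced by its norm,
hence a half circle. -/
theorem stdGaussian_map_head_norm (k : ℕ) :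
    (stdGaussian (EuclideanSpace ℝ (Fin (k + 2)))).map (fun h => (h 0, ‖h‖)) =
      ((chiLaw (k + 2)).prod (angleLaw (k + 2))).map fun p => (p.1 * axisCos (k + 2) p.2, p.1) := by
  have := isProbabilityMeasure_chiLaw (k + 2)
  have := isProbabilityMeasure_angleLaw k
  have hm := measurable_axisCos (k + 2)
  have hpos := (Measure.quasiMeasurePreserving_fst (μ := chiLaw (k + 2))
    (ν := angleLaw (k + 2))).ae (ae_pos_chiLaw k)
  rcases k with _ | k
  · have h : (fun h : EuclideanSpace ℝ (Fin 2) => (h 0, ‖h‖)) =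
      (fun p : ℝ × ℝ => (p.1, √(p.1 ^ 2 + p.2 ^ 2))) ∘ fun h => (h 0, h 1) := by
      ext h <;> simp [EuclideanSpace.norm_eq]
    rw [h, ← Measure.map_map (by fun_prop) (by fun_prop), stdGaussian_fin_two_polar,
      Measure.map_map (by fun_prop) (by fun_prop)]
    refine Measure.map_congr ?_
    filter_upwards [hpos] with p hp
    have : (p.1 * Real.cos (2 * Real.pi * p.2)) ^ 2 + (p.1 * Real.sin (2 * Real.pi * p.2)) ^ 2
        = p.1 ^ 2 := by
      linear_combination p.1 ^ 2 * Real.sin_sq_add_cos_sq (2 * Real.pi * p.2)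
    simp [this, Real.sqrt_sq hp.le, axisCos]
  · have h : (fun h : EuclideanSpace ℝ (Fin (k + 2 + 1)) => (h 0, ‖h‖)) =
      (fun p : ℝ × ℝ => (p.1, √(p.1 ^ 2 + p.2 ^ 2))) ∘ fun h =>
        (h 0, ‖(WithLp.toLp 2 fun i : Fin (k + 2) => h i.succ : EuclideanSpace ℝ (Fin (k + 2)))‖) := by
      ext h
      · rfl
      · exact norm_eq_sqrt_cons h
    rw [h, ← Measure.map_map (by fun_prop) (by fun_prop), stdGaussian_map_head_norm_tail,
      gaussianReal_prod_chiLaw, Measure.map_map (by fun_prop) (by fun_prop)]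
    refine Measure.map_congr ?_
    filter_upwards [hpos] with p hp
    have : (p.1 * Real.cos (Real.pi * p.2)) ^ 2 + (p.1 * Real.sin (Real.pi * p.2)) ^ 2
        = p.1 ^ 2 := by
      linear_combination p.1 ^ 2 * Real.sin_sq_add_cos_sq (Real.pi * p.2)
    simp [this, Real.sqrt_sq hp.le, axisCos]

/-- The joint law of the norm and the first two coordinates of a standard Gaussian vector. -/
theorem stdGaussian_map_two_heads_norm (k : ℕ) :
    (stdGaussian (EuclideanSpace ℝ (Fin (k + 3)))).map (fun h => ((h 0, h 1), ‖h‖)) =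
      (((chiLaw (k + 3)).prod (angleLaw (k + 3))).prod (angleLaw (k + 2))).map fun p =>
        ((p.1.1 * Real.cos (Real.pi * p.1.2),
          p.1.1 * Real.sin (Real.pi * p.1.2) * axisCos (k + 2) p.2), p.1.1) := by
  have := isProbabilityMeasure_chiLaw (k + 2)
  have := isProbabilityMeasure_chiLaw (k + 3)
  have := isProbabilityMeasure_angleLaw k
  have := isProbabilityMeasure_angleLaw (k + 1)
  have hm := measurable_axisCos (k + 2)
  -- The first coordinate is split off and the tail is described by its own first coordinate and
  -- norm. The tail brings the second angle; the pair of first coordinate and tail norm then brings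
  -- the first.
  have h : (fun h : EuclideanSpace ℝ (Fin (k + 2 + 1)) => ((h 0, h 1), ‖h‖)) =
      (fun p : ℝ × ℝ × ℝ => ((p.1, p.2.1), √(p.1 ^ 2 + p.2.2 ^ 2))) ∘
      (Prod.map id fun h : EuclideanSpace ℝ (Fin (k + 2)) => (h 0, ‖h‖)) ∘ fun h =>
        (h 0, (WithLp.toLp 2 fun i : Fin (k + 2) => h i.succ : EuclideanSpace ℝ (Fin (k + 2)))) := by
    ext h
    · rfl
    · rfl
    · exact norm_eq_sqrt_cons h
  rw [h, ← Measure.map_map (by fun_prop) (by fun_prop), ← Measure.map_map (by fun_prop)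
    (by fun_prop), stdGaussian_map_cons, ← Measure.map_prod_map _ _ measurable_id (by fun_prop),
    stdGaussian_map_head_norm, Measure.map_prod_map _ _ measurable_id (by fun_prop),
    ← (measurePreserving_prodAssoc (gaussianReal 0 1) (chiLaw (k + 2)) (angleLaw (k + 2))).map_eq,
    gaussianReal_prod_chiLaw]
  have h4 := Measure.map_prod_map ((chiLaw (k + 3)).prod (angleLaw (k + 3))) (angleLaw (k + 2))
    (f := fun p => (p.1 * Real.cos (Real.pi * p.2), p.1 * Real.sin (Real.pi * p.2)))
    (g := id) (by fun_prop) measurable_id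
  rw [Measure.map_id] at h4
  have hq : Measurable ((Prod.map id fun p : ℝ × ℝ => (p.1 * axisCos (k + 2) p.2, p.1)) ∘
      (MeasurableEquiv.prodAssoc : (ℝ × ℝ) × ℝ ≃ᵐ ℝ × ℝ × ℝ)) :=
    Measurable.comp (by fun_prop) MeasurableEquiv.prodAssoc.measurable
  rw [h4, Measure.map_map (by fun_prop) MeasurableEquiv.prodAssoc.measurable,
    Measure.map_map (by fun_prop) hq, Measure.map_map (Measurable.comp (by fun_prop) hq)
    (by fun_prop)]
  refine Measure.map_congr ?_
  have hpos := (Measure.quasiMeasurePreserving_fst (μ := (chiLaw (k + 3)).prod (angleLaw (k + 3)))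
    (ν := angleLaw (k + 2))).ae ((Measure.quasiMeasurePreserving_fst (μ := chiLaw (k + 3))
    (ν := angleLaw (k + 3))).ae (ae_pos_chiLaw (k + 1)))
  filter_upwards [hpos] with p hp
  have : (p.1.1 * Real.cos (Real.pi * p.1.2)) ^ 2 + (p.1.1 * Real.sin (Real.pi * p.1.2)) ^ 2
      = p.1.1 ^ 2 := by
    linear_combination p.1.1 ^ 2 * Real.sin_sq_add_cos_sq (Real.pi * p.1.2)
  simp [MeasurableEquiv.prodAssoc, this, Real.sqrt_sq hp.le]

/-! ### Existence of the densities -/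

/-- The law of `√(V / m)` for `V ∼ χ²_m`. -/
def scaledChiLaw (m : ℕ) : Measure ℝ := (chiSquared m).map fun x => √(x / m)

theorem isProbabilityMeasure_scaledChiLaw (m : ℕ) : IsProbabilityMeasure (scaledChiLaw m) := by
  have := isProbabilityMeasure_chiSquared m
  exact Measure.isProbabilityMeasure_map (by fun_prop)

theorem isProbabilityMeasure_noncentralChiSquared (k : ℕ) (lam : ℝ) :
    IsProbabilityMeasure (noncentralChiSquared k lam) :=
  Measure.isProbabilityMeasure_map (by fun_prop)

/-- Given the other coordinates, the variable is a translated square of one normal coordinate plus a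
constant, and null sets pull back to null sets under such a map. Fubini finishes the argument. -/
theorem noncentralChiSquared_absolutelyContinuous {k : ℕ} (hk : 0 < k) (lam : ℝ) :
    noncentralChiSquared k lam ≪ volume := by
  obtain ⟨k, rfl⟩ : ∃ j, k = j + 1 := ⟨k - 1, by omega⟩
  have h : noncentralChiSquared (k + 1) lam =
      ((gaussianReal 0 1).prod (stdGaussian (EuclideanSpace ℝ (Fin k)))).map
        fun p => (p.1 + √lam) ^ 2 + ‖p.2‖ ^ 2 := by
    rw [← stdGaussian_map_cons, Measure.map_map (by fun_prop) (by fun_prop), noncentralChiSquared]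
    congr 1
    ext z
    simp [Fin.sum_univ_succ, EuclideanSpace.real_norm_sq_eq]
  rw [h]
  refine Measure.AbsolutelyContinuous.mk fun N hN hN0 => ?_
  have hm : Measurable fun p : ℝ × EuclideanSpace ℝ (Fin k) => (p.1 + √lam) ^ 2 + ‖p.2‖ ^ 2 := by
    fun_prop
  rw [Measure.map_apply hm hN, Measure.prod_apply_symm (hm hN)]
  refine (lintegral_congr fun z => ?_).trans lintegral_zero
  exact gaussianReal_absolutelyContinuous 0 one_ne_zero
    (volume_preimage_sq_eq_zero hN0 (√lam) (‖z‖ ^ 2))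

theorem chiSquared_absolutelyContinuous {k : ℕ} (hk : 0 < k) : chiSquared k ≪ volume := by
  have h : chiSquared k = noncentralChiSquared k 0 := by simp [chiSquared, noncentralChiSquared]
  rw [h]
  exact noncentralChiSquared_absolutelyContinuous hk 0

/-- The square root collapses the half line `Set.Iic 0` to one point, so that half line is treated
separately: χ² gives it no mass. -/
theorem chiSquared_map_sqrt_div_absolutelyContinuous {k : ℕ} (hk : 0 < k) {c : ℝ} (hc : 0 < c) :
    (chiSquared k).map (fun x => √(x / c)) ≪ volume := by
  refine Measure.AbsolutelyContinuous.mk fun N hN hN0 => ?_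
  rw [Measure.map_apply (by fun_prop) hN]
  refine measure_mono_null (t := ((fun x : ℝ => √(x / c)) ⁻¹' N ∩ Set.Ioi 0) ∪ Set.Iic 0)
    (fun x hx => ?_) (measure_union_null (chiSquared_absolutelyContinuous hk
      (volume_preimage_sqrt_div_inter_Ioi_eq_zero hN0 hc)) (chiSquared_Iic_zero hk))
  rcases le_or_gt x 0 with h | h
  · exact Or.inr h
  · exact Or.inl ⟨hx, h⟩

theorem chiLaw_absolutelyContinuous {k : ℕ} (hk : 0 < k) : chiLaw k ≪ volume := by
  simpa [chiLaw] using chiSquared_map_sqrt_div_absolutelyContinuous hk one_pos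

theorem scaledChiLaw_absolutelyContinuous {m : ℕ} (hm : 0 < m) : scaledChiLaw m ≪ volume :=
  chiSquared_map_sqrt_div_absolutelyContinuous hm (by exact_mod_cast hm)

theorem ae_pos_scaledChiLaw {m : ℕ} (hm : 0 < m) : ∀ᵐ w ∂scaledChiLaw m, 0 < w := by
  rw [scaledChiLaw, ae_map_iff (by fun_prop) measurableSet_Ioi]
  have h : ∀ᵐ v ∂chiSquared m, 0 < v := by
    simpa [ae_iff, Set.Iic] using chiSquared_Iic_zero hm
  filter_upwards [h] with v hv
  exact Real.sqrt_pos.2 (by positivity)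

theorem ae_nonneg_noncentralChiSquared (k : ℕ) (lam : ℝ) :
    ∀ᵐ q ∂noncentralChiSquared k lam, 0 ≤ q := by
  rw [noncentralChiSquared, ae_map_iff (by fun_prop) measurableSet_Ici]
  exact Filter.Eventually.of_forall fun z => Finset.sum_nonneg fun i _ => sq_nonneg _

/-! ### Orthonormal families and rotations -/

variable {E : Type*} [NormedAddCommGroup E] [InnerProductSpace ℝ E] [FiniteDimensional ℝ E]
  [MeasurableSpace E] [BorelSpace E]

/-- The coordinates of a standard Gaussian vector along an orthonormal family are independent
standard normal variables. -/
theorem stdGaussian_map_inner_orthonormal {ι : Type*} [Fintype ι] {v : ι → E}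
    (hv : Orthonormal ℝ v) :
    (stdGaussian E).map (fun x i => inner ℝ (v i) x) = Measure.pi fun _ => gaussianReal 0 1 := by
  have hm : Measurable fun (x : E) (i : ι) => inner ℝ (v i) x := by fun_prop
  have hprob : IsProbabilityMeasure ((stdGaussian E).map fun x i => inner ℝ (v i) x) :=
    Measure.isProbabilityMeasure_map hm.aemeasurable
  have key : ((stdGaussian E).map (fun x i => inner ℝ (v i) x)).map (WithLp.toLp 2) =
      stdGaussian (EuclideanSpace ℝ ι) := by
    have := Measure.isProbabilityMeasure_map (μ := (stdGaussian E).map fun x i => inner ℝ (v i) x)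
      (WithLp.measurable_toLp 2 (ι → ℝ)).aemeasurable
    apply Measure.ext_of_charFun (E := EuclideanSpace ℝ ι)
    ext t
    -- The characteristic function of the coordinates at t is that of x at ∑ tᵢvᵢ. Orthonormality
    -- gives this vector the norm of t, and the Gaussian characteristic function depends only on the
    -- norm.
    have h1 : ∀ x : E, inner ℝ (WithLp.toLp 2 fun i => inner ℝ (v i) x : EuclideanSpace ℝ ι) t =
        inner ℝ x (∑ i, t i • v i) := by
      intro x
      simp [PiLp.inner_apply, inner_sum, inner_smul_right, real_inner_comm x]
    have h2 : ‖∑ i, t i • v i‖ ^ 2 = ‖t‖ ^ 2 := by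
      rw [← real_inner_self_eq_norm_sq, hv.inner_sum, EuclideanSpace.real_norm_sq_eq]
      simp [sq]
    rw [Measure.map_map (by fun_prop) hm, charFun_apply,
      integral_map (by fun_prop) (by fun_prop)]
    simp only [Function.comp_apply, h1]
    rw [← charFun_apply, charFun_stdGaussian, charFun_stdGaussian, ← Complex.ofReal_pow, h2,
      Complex.ofReal_pow]
  rw [← map_pi_eq_stdGaussian] at key
  have h3 : ∀ ν : Measure (ι → ℝ), (ν.map (WithLp.toLp 2)).map WithLp.ofLp = ν := fun ν => by
    rw [Measure.map_map (by fun_prop) (by fun_prop)]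
    exact Measure.map_id
  rw [← h3 ((stdGaussian E).map _), key, h3]

/-- A product measure over a sum of index types is a product of product measures. The blocks will be
the error of τ̂, the residuals and the remaining noise of Θ̂. -/
theorem stdGaussian_map_three_blocks {s m : ℕ} {u : Fin s → E} {f : Fin m → E} {e : E}
    (hv : Orthonormal ℝ (Sum.elim (Sum.elim u f) fun _ : Unit => e)) :
    (stdGaussian E).map (fun x => (((WithLp.toLp 2 fun i => inner ℝ (u i) x :
        EuclideanSpace ℝ (Fin s)), (WithLp.toLp 2 fun j => inner ℝ (f j) x :
        EuclideanSpace ℝ (Fin m))), inner ℝ e x)) =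
      ((stdGaussian (EuclideanSpace ℝ (Fin s))).prod
        (stdGaussian (EuclideanSpace ℝ (Fin m)))).prod (gaussianReal 0 1) := by
  have h0 := stdGaussian_map_inner_orthonormal hv
  have h1 := (measurePreserving_sumPiEquivProdPi
    (fun _ : (Fin s ⊕ Fin m) ⊕ Unit => gaussianReal 0 1)).map_eq
  have h2 := (measurePreserving_sumPiEquivProdPi
    (fun _ : Fin s ⊕ Fin m => gaussianReal 0 1)).map_eq
  have h3 := (measurePreserving_piUnique (fun _ : Unit => gaussianReal 0 1)).map_eq
  have hm1 : Measurable (Prod.map (WithLp.toLp 2 : (Fin s → ℝ) → EuclideanSpace ℝ (Fin s))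
      (WithLp.toLp 2 : (Fin m → ℝ) → EuclideanSpace ℝ (Fin m))) := by fun_prop
  have hm2 := hm1.comp (MeasurableEquiv.sumPiEquivProdPi fun _ : Fin s ⊕ Fin m => ℝ).measurable
  have hm3 := hm2.prodMap (MeasurableEquiv.piUnique fun _ : Unit => ℝ).measurable
  have hm4 := hm3.comp
    (MeasurableEquiv.sumPiEquivProdPi fun _ : (Fin s ⊕ Fin m) ⊕ Unit => ℝ).measurable
  have h4 : (stdGaussian (EuclideanSpace ℝ (Fin s))).prod
      (stdGaussian (EuclideanSpace ℝ (Fin m))) =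
      (Measure.pi fun _ : Fin s ⊕ Fin m => gaussianReal 0 1).map
        (Prod.map (WithLp.toLp 2) (WithLp.toLp 2) ∘
          MeasurableEquiv.sumPiEquivProdPi fun _ : Fin s ⊕ Fin m => ℝ) := by
    rw [← Measure.map_map hm1 (MeasurableEquiv.measurable _), h2,
      ← Measure.map_prod_map _ _ (by fun_prop) (by fun_prop), map_pi_eq_stdGaussian,
      map_pi_eq_stdGaussian]
  have h5 : ((Measure.pi fun _ : Fin s ⊕ Fin m => gaussianReal 0 1).map
        (Prod.map (WithLp.toLp 2) (WithLp.toLp 2) ∘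
          MeasurableEquiv.sumPiEquivProdPi fun _ : Fin s ⊕ Fin m => ℝ)).prod
      ((Measure.pi fun _ : Unit => gaussianReal 0 1).map
        (MeasurableEquiv.piUnique fun _ : Unit => ℝ)) =
      (Measure.pi fun _ : (Fin s ⊕ Fin m) ⊕ Unit => gaussianReal 0 1).map
        (Prod.map (Prod.map (WithLp.toLp 2) (WithLp.toLp 2) ∘
          MeasurableEquiv.sumPiEquivProdPi fun _ : Fin s ⊕ Fin m => ℝ)
          (MeasurableEquiv.piUnique fun _ : Unit => ℝ) ∘
          MeasurableEquiv.sumPiEquivProdPi fun _ : (Fin s ⊕ Fin m) ⊕ Unit => ℝ) := by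
    rw [Measure.map_prod_map _ _ hm2 (MeasurableEquiv.measurable _), ← h1,
      Measure.map_map hm3 (MeasurableEquiv.measurable _)]
  rw [h3] at h5
  rw [h4, h5, ← h0, Measure.map_map hm4 (by fun_prop)]
  rfl

/-- For r ≠ 0 normalize r. For r = 0, which occurs when b is parallel to the axis, any unit vector
orthogonal to e serves; one exists because the dimension is at least two. -/
theorem exists_unit_orthogonal_smul {k : ℕ} (e r : EuclideanSpace ℝ (Fin (k + 2)))
    (hr : inner ℝ e r = 0) :
    ∃ f : EuclideanSpace ℝ (Fin (k + 2)), ‖f‖ = 1 ∧ inner ℝ e f = 0 ∧ r = ‖r‖ • f := by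
  by_cases h : r = 0
  · have hd : 0 < Module.finrank ℝ (ℝ ∙ e)ᗮ := by
      have h1 := Submodule.finrank_add_finrank_orthogonal (ℝ ∙ e)
      have h2 : Module.finrank ℝ (ℝ ∙ e) ≤ 1 := by
        simpa using finrank_span_le_card (R := ℝ) ({e} : Set (EuclideanSpace ℝ (Fin (k + 2))))
      have h3 : Module.finrank ℝ (EuclideanSpace ℝ (Fin (k + 2))) = k + 2 := by simp
      omega
    have := Module.finrank_pos_iff.1 hd
    obtain ⟨x, hx⟩ := exists_norm_eq (E := (ℝ ∙ e)ᗮ) zero_le_one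
    refine ⟨x, by simpa using hx, ?_, by simp [h]⟩
    exact (Submodule.mem_orthogonal_singleton_iff_inner_right).1 x.2
  · have hn : ‖r‖ ≠ 0 := norm_ne_zero_iff.2 h
    refine ⟨‖r‖⁻¹ • r, ?_, ?_, ?_⟩
    · rw [norm_smul, norm_inv, norm_norm, inv_mul_cancel₀ hn]
    · rw [inner_smul_right, hr, mul_zero]
    · rw [smul_smul, mul_inv_cancel₀ hn, one_smul]

/-- Gram–Schmidt on e and b, extended to an orthonormal basis, with L the coordinate map. The
component of b orthogonal to e has norm ‖b‖√(1 - ψ²). For b = 0 the number ψ is arbitrary, but every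
term then carries the factor ‖b‖ = 0. -/
theorem exists_rotation_of_unit {k : ℕ} (e b : EuclideanSpace ℝ (Fin (k + 2))) (he : ‖e‖ = 1)
    (ψ : ℝ) (hψ : inner ℝ e b = ‖b‖ * ψ) :
    ∃ L : EuclideanSpace ℝ (Fin (k + 2)) ≃ₗᵢ[ℝ] EuclideanSpace ℝ (Fin (k + 2)), ∀ h,
      inner ℝ e h = L h 0 ∧ inner ℝ b h = ‖b‖ * (ψ * L h 0 + √(1 - ψ ^ 2) * L h 1) := by
  have hee : inner ℝ e e = 1 := by rw [real_inner_self_eq_norm_sq, he, one_pow]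
  obtain ⟨f, hf, hef, hr⟩ := exists_unit_orthogonal_smul e (b - (‖b‖ * ψ) • e) (by
    rw [inner_sub_right, inner_smul_right, hψ, hee]; ring)
  have hnr : ‖b - (‖b‖ * ψ) • e‖ = ‖b‖ * √(1 - ψ ^ 2) := by
    rw [← Real.sqrt_sq (norm_nonneg (b - (‖b‖ * ψ) • e)), norm_sub_sq_real, inner_smul_right,
      real_inner_comm, hψ, norm_smul, he, mul_one, Real.norm_eq_abs, sq_abs]
    rw [show ‖b‖ ^ 2 - 2 * (‖b‖ * ψ * (‖b‖ * ψ)) + (‖b‖ * ψ) ^ 2 = ‖b‖ ^ 2 * (1 - ψ ^ 2) by ring,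
      Real.sqrt_mul (sq_nonneg _), Real.sqrt_sq (norm_nonneg _)]
  let v : Fin (k + 2) → EuclideanSpace ℝ (Fin (k + 2)) := fun i => if i = 0 then e else f
  have hv : Orthonormal ℝ (({0, 1} : Set (Fin (k + 2))).domRestrict v) := by
    constructor
    · rintro ⟨i, hi⟩
      rcases hi with rfl | hi
      · simpa [v, Set.domRestrict] using he
      · have : i = 1 := hi
        subst this
        simpa [v, Set.domRestrict] using hf
    · rintro ⟨i, hi⟩ ⟨j, hj⟩ hij
      have hij' : i ≠ j := fun h => hij (Subtype.ext h)
      rcases hi with rfl | hi <;> rcases hj with rfl | hj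
      · exact absurd rfl hij'
      · have : j = 1 := hj
        subst this
        simpa [v, Set.domRestrict] using hef
      · have : i = 1 := hi
        subst this
        simpa [v, Set.domRestrict, real_inner_comm] using hef
      · have h1 : i = 1 := hi
        have h2 : j = 1 := hj
        exact absurd (h1.trans h2.symm) hij'
  obtain ⟨B, hB⟩ := hv.exists_orthonormalBasis_extension_of_card_eq (by simp)
  have hB0 : B 0 = e := by rw [hB 0 (by simp)]; simp [v]
  have hB1 : B 1 = f := by rw [hB 1 (by simp)]; simp [v]
  refine ⟨B.repr, fun h => ?_⟩
  rw [B.repr_apply_apply, B.repr_apply_apply, hB0, hB1]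
  refine ⟨rfl, ?_⟩
  have hb : b = (‖b‖ * ψ) • e + (‖b‖ * √(1 - ψ ^ 2)) • f := by
    rw [← hnr, ← hr]; abel
  conv_lhs => rw [hb]
  rw [inner_add_left, inner_smul_left, inner_smul_left]
  simp only [conj_trivial]
  ring

/-- A rotation that takes `γ` to the first axis and `b` to the span of the first two axes. -/
theorem exists_rotation {k : ℕ} (γ b : EuclideanSpace ℝ (Fin (k + 2))) (ψ : ℝ)
    (hψ : ψ = if γ = 0 then 1 else inner ℝ (‖b‖⁻¹ • b) (‖γ‖⁻¹ • γ)) :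
    ∃ L : EuclideanSpace ℝ (Fin (k + 2)) ≃ₗᵢ[ℝ] EuclideanSpace ℝ (Fin (k + 2)), ∀ h,
      inner ℝ γ h = ‖γ‖ * L h 0 ∧ inner ℝ b h = ‖b‖ * (ψ * L h 0 + √(1 - ψ ^ 2) * L h 1) := by
  by_cases hγ : γ = 0
  · rw [if_pos hγ] at hψ
    subst hψ
    by_cases hb : b = 0
    · exact ⟨LinearIsometryEquiv.refl ℝ _, fun h => by simp [hγ, hb]⟩
    · have hn : ‖b‖ ≠ 0 := norm_ne_zero_iff.2 hb
      -- With γ = 0 the first axis is free; taking it along b matches the convention ψ = 1.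
      obtain ⟨L, hL⟩ := exists_rotation_of_unit (‖b‖⁻¹ • b) b (by
        rw [norm_smul, norm_inv, norm_norm, inv_mul_cancel₀ hn]) 1 (by
        rw [real_inner_smul_left, real_inner_self_eq_norm_sq]; field_simp)
      exact ⟨L, fun h => ⟨by simp [hγ], (hL h).2⟩⟩
  · rw [if_neg hγ] at hψ
    have hn : ‖γ‖ ≠ 0 := norm_ne_zero_iff.2 hγ
    obtain ⟨L, hL⟩ := exists_rotation_of_unit (‖γ‖⁻¹ • γ) b (by
        rw [norm_smul, norm_inv, norm_norm, inv_mul_cancel₀ hn]) ψ (by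
        rw [hψ, real_inner_smul_left, real_inner_smul_left, real_inner_smul_right, real_inner_comm]
        by_cases hb : b = 0
        · simp [hb]
        · have hn : ‖b‖ ≠ 0 := norm_ne_zero_iff.2 hb
          field_simp)
    refine ⟨L, fun h => ⟨?_, (hL h).2⟩⟩
    rw [← (hL h).1, real_inner_smul_left, mul_inv_cancel_left₀ hn]

theorem norm_add_sq_eq_of_rotation {k : ℕ} {γ : EuclideanSpace ℝ (Fin (k + 2))}
    {L : EuclideanSpace ℝ (Fin (k + 2)) ≃ₗᵢ[ℝ] EuclideanSpace ℝ (Fin (k + 2))}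
    (hL : ∀ h, inner ℝ γ h = ‖γ‖ * L h 0) (h : EuclideanSpace ℝ (Fin (k + 2))) :
    ‖γ + h‖ ^ 2 = ‖γ‖ ^ 2 + 2 * ‖γ‖ * L h 0 + ‖L h‖ ^ 2 := by
  rw [norm_add_sq_real, hL, L.norm_map]
  ring

/-- By rotation invariance the shift γ may be moved to ‖γ‖ times the first axis, the only coordinate
shifted in the definition of the noncentral law. -/
theorem stdGaussian_map_norm_add_sq {k : ℕ} {γ : EuclideanSpace ℝ (Fin (k + 2))}
    {L : EuclideanSpace ℝ (Fin (k + 2)) ≃ₗᵢ[ℝ] EuclideanSpace ℝ (Fin (k + 2))}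
    (hL : ∀ h, inner ℝ γ h = ‖γ‖ * L h 0) :
    (stdGaussian (EuclideanSpace ℝ (Fin (k + 2)))).map (fun h => ‖γ + h‖ ^ 2) =
      noncentralChiSquared (k + 2) (‖γ‖ ^ 2) := by
  rw [noncentralChiSquared]
  nth_rw 2 [← stdGaussian_map L]
  rw [Measure.map_map (by fun_prop) (by fun_prop)]
  congr 1
  ext h
  rw [norm_add_sq_eq_of_rotation hL, EuclideanSpace.real_norm_sq_eq (L h)]
  simp only [Function.comp_apply, Fin.sum_univ_succ (n := k + 1)]
  simp [Real.sqrt_sq (norm_nonneg γ)]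
  ring

/-! ### Algebra of the estimators and their standardized noise -/

namespace Regression

variable {n p s : ℕ} (D : Regression n p s)

theorem isUnit_det_gram : IsUnit D.gram.det :=
  (Matrix.isUnit_iff_isUnit_det _).1 D.gram_posDef.isUnit

theorem isUnit_det_V : IsUnit D.V₂₂.det :=
  (Matrix.isUnit_iff_isUnit_det _).1 D.V_posDef.isUnit

theorem gram_inv_transpose : (D.gram⁻¹)ᵀ = D.gram⁻¹ := by
  rw [Matrix.transpose_nonsing_inv]
  congr 1
  simp [gram]

theorem sqrt_V_mul_self : CFC.sqrt D.V₂₂ * CFC.sqrt D.V₂₂ = D.V₂₂ :=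
  CFC.sqrt_mul_sqrt_self _ D.V_posDef.posSemidef.nonneg

theorem isUnit_det_sqrt_V : IsUnit (CFC.sqrt D.V₂₂).det := by
  have h := D.isUnit_det_V
  rw [← D.sqrt_V_mul_self, Matrix.det_mul] at h
  exact isUnit_of_mul_isUnit_left h

theorem V₂₂invSqrt_transpose : D.V₂₂invSqrtᵀ = D.V₂₂invSqrt := by
  have h : (CFC.sqrt D.V₂₂).IsHermitian := (CFC.sqrt_nonneg D.V₂₂).isSelfAdjoint
  have h' := h.inv
  simpa [V₂₂invSqrt, Matrix.IsHermitian] using h'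

theorem V₂₂invSqrt_mul_self : D.V₂₂invSqrt * D.V₂₂invSqrt = D.V₂₂⁻¹ := by
  rw [V₂₂invSqrt, ← Matrix.mul_inv_rev, D.sqrt_V_mul_self]

theorem V₂₂invSqrt_mul_V_mul : D.V₂₂invSqrt * D.V₂₂ * D.V₂₂invSqrt = 1 := by
  rw [V₂₂invSqrt]
  nth_rw 2 [← D.sqrt_V_mul_self]
  rw [← Matrix.mul_assoc, Matrix.nonsing_inv_mul _ D.isUnit_det_sqrt_V, Matrix.one_mul,
    Matrix.mul_nonsing_inv _ D.isUnit_det_sqrt_V]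

theorem dotProduct_V_inv_mulVec (x y : Fin s → ℝ) :
    x ⬝ᵥ (D.V₂₂⁻¹ *ᵥ y) = (D.V₂₂invSqrt *ᵥ x) ⬝ᵥ (D.V₂₂invSqrt *ᵥ y) := by
  rw [← D.V₂₂invSqrt_mul_self, ← mulVec_mulVec, dotProduct_mulVec, ← mulVec_transpose,
    D.V₂₂invSqrt_transpose]

theorem v₁₁_pos : 0 < D.v₁₁ := by
  have ha : D.a ≠ 0 := fun h => D.a_notMem_span (h ▸ Submodule.zero_mem _)
  simpa [v₁₁] using D.gram_posDef.inv.dotProduct_mulVec_pos ha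

/-- The linear map from the noise to the standardized error of `τ̂`. -/
def errMatrix : Matrix (Fin s) (Fin n) ℝ := D.V₂₂invSqrt * (D.Cᵀ * (D.gram⁻¹ * D.Xᵀ))

theorem errMatrix_mul_X : D.errMatrix * D.X = D.V₂₂invSqrt * D.Cᵀ := by
  have h : D.gram⁻¹ * (D.Xᵀ * D.X) = 1 := Matrix.nonsing_inv_mul _ D.isUnit_det_gram
  simp only [errMatrix, Matrix.mul_assoc]
  rw [h, Matrix.mul_one]

theorem errMatrix_transpose :
    D.errMatrixᵀ = D.X * (D.gram⁻¹ * (D.C * D.V₂₂invSqrt)) := by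
  simp only [errMatrix, Matrix.transpose_mul, D.V₂₂invSqrt_transpose, D.gram_inv_transpose,
    Matrix.transpose_transpose, Matrix.mul_assoc]

/-- Before standardization the covariance of τ̂ is σ²V₂₂; the factor V₂₂^{-1/2} on either side makes
it the identity. Equivalently, the rows are orthonormal. -/
theorem errMatrix_mul_transpose : D.errMatrix * D.errMatrixᵀ = 1 := by
  rw [errMatrix_transpose, ← Matrix.mul_assoc, errMatrix_mul_X, ← D.V₂₂invSqrt_mul_V_mul, V₂₂]
  simp only [Matrix.mul_assoc]

theorem errMatrix_mulVec_X (x : Fin p → ℝ) :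
    D.errMatrix *ᵥ (D.X *ᵥ x) = D.V₂₂invSqrt *ᵥ (D.Cᵀ *ᵥ x) := by
  rw [mulVec_mulVec, errMatrix_mul_X, mulVec_mulVec]

/-- The vector is the noise direction of Θ̂, scaled to unit length. Its coordinates along the rows
of `errMatrix` are its correlations with the standardized τ̂, that is, b. -/
theorem errMatrix_mulVec_leverage :
    D.errMatrix *ᵥ ((√D.v₁₁)⁻¹ • (D.X *ᵥ (D.gram⁻¹ *ᵥ D.a))) = D.b.ofLp := by
  rw [mulVec_smul, errMatrix_mulVec_X]
  rfl

/-- The component of the noise direction of `Θ̂` that is orthogonal to the noise of `τ̂`. -/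
def residDir : Fin n → ℝ :=
  (√D.v₁₁)⁻¹ • (D.X *ᵥ (D.gram⁻¹ *ᵥ D.a)) - D.errMatrixᵀ *ᵥ D.b.ofLp

theorem errMatrix_mulVec_residDir : D.errMatrix *ᵥ D.residDir = 0 := by
  rw [residDir, mulVec_sub, errMatrix_mulVec_leverage, mulVec_mulVec, errMatrix_mul_transpose,
    one_mulVec, sub_self]

theorem X_mulVec_dotProduct (x : Fin p → ℝ) (z : Fin n → ℝ) :
    (D.X *ᵥ x) ⬝ᵥ z = x ⬝ᵥ (D.Xᵀ *ᵥ z) := by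
  rw [dotProduct_comm, dotProduct_mulVec, ← mulVec_transpose, dotProduct_comm]

theorem gram_inv_mulVec_dotProduct (x z : Fin p → ℝ) :
    (D.gram⁻¹ *ᵥ x) ⬝ᵥ z = x ⬝ᵥ (D.gram⁻¹ *ᵥ z) := by
  rw [dotProduct_comm, dotProduct_mulVec, ← mulVec_transpose, D.gram_inv_transpose, dotProduct_comm]

theorem leverage_dotProduct_self :
    (D.X *ᵥ (D.gram⁻¹ *ᵥ D.a)) ⬝ᵥ (D.X *ᵥ (D.gram⁻¹ *ᵥ D.a)) = D.v₁₁ := by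
  rw [X_mulVec_dotProduct, mulVec_mulVec]
  change _ ⬝ᵥ D.gram *ᵥ _ = _
  rw [mulVec_mulVec, Matrix.mul_nonsing_inv _ D.isUnit_det_gram, one_mulVec, dotProduct_comm, v₁₁]

theorem b_dotProduct_self : D.b.ofLp ⬝ᵥ D.b.ofLp = ‖D.b‖ ^ 2 := by
  rw [EuclideanSpace.real_norm_sq_eq]
  simp [dotProduct, sq]

/-- Pythagoras: a unit vector minus its projection onto the rows of `errMatrix`, whose coordinates
are b. -/
theorem residDir_dotProduct_self : D.residDir ⬝ᵥ D.residDir = 1 - ‖D.b‖ ^ 2 := by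
  have hv := D.v₁₁_pos
  have h1 : ∀ z, (D.errMatrixᵀ *ᵥ D.b.ofLp) ⬝ᵥ z = D.b.ofLp ⬝ᵥ (D.errMatrix *ᵥ z) := by
    intro z
    rw [mulVec_transpose, ← dotProduct_mulVec]
  have h2 : D.residDir ⬝ᵥ D.residDir =
      ((√D.v₁₁)⁻¹ • (D.X *ᵥ (D.gram⁻¹ *ᵥ D.a))) ⬝ᵥ D.residDir := by
    nth_rw 1 [residDir]
    rw [sub_dotProduct, h1, errMatrix_mulVec_residDir, dotProduct_zero, sub_zero]
  rw [h2, residDir, dotProduct_sub, dotProduct_comm _ (D.errMatrixᵀ *ᵥ _), h1,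
    errMatrix_mulVec_leverage, b_dotProduct_self, smul_dotProduct, dotProduct_smul,
    leverage_dotProduct_self]
  simp only [smul_eq_mul]
  rw [← mul_assoc, ← mul_inv, Real.mul_self_sqrt hv.le, inv_mul_cancel₀ hv.ne']

theorem residDir_eq : D.residDir = D.X *ᵥ (D.gram⁻¹ *ᵥ
    ((√D.v₁₁)⁻¹ • D.a - D.C *ᵥ (D.V₂₂invSqrt *ᵥ D.b.ofLp))) := by
  rw [residDir, errMatrix_transpose, mulVec_sub, mulVec_sub, mulVec_smul, mulVec_smul]
  simp only [mulVec_mulVec]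

/-- Equality would make `residDir` zero. Cancelling X and the Gram matrix in `residDir_eq` would
then put a into the column space of C, which is excluded. -/
theorem one_sub_norm_b_sq_pos : 0 < 1 - ‖D.b‖ ^ 2 := by
  have hv := D.v₁₁_pos
  have h0 : 0 ≤ D.residDir ⬝ᵥ D.residDir := by
    simpa using dotProduct_star_self_nonneg D.residDir
  rw [← residDir_dotProduct_self]
  refine lt_of_le_of_ne h0 fun h => ?_
  have hz : D.residDir = 0 := dotProduct_self_eq_zero.1 h.symm
  rw [residDir_eq] at hz
  have hinj := Matrix.mulVec_injective_iff.2 D.linearIndependent_X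
  have h1 := hinj (hz.trans (mulVec_zero D.X).symm)
  have h2 := congrArg (D.gram *ᵥ ·) h1
  simp only [mulVec_mulVec, Matrix.mul_nonsing_inv _ D.isUnit_det_gram, one_mulVec,
    mulVec_zero] at h2
  rw [sub_eq_zero, inv_smul_eq_iff₀ (Real.sqrt_pos.2 hv).ne'] at h2
  refine D.a_notMem_span ?_
  rw [h2, ← Matrix.range_mulVecLin]
  refine Submodule.smul_mem _ _ ⟨D.V₂₂invSqrt *ᵥ D.b.ofLp, ?_⟩
  simp

/-- The response that corresponds to the standardized noise `ε`. -/
def response (β : Fin p → ℝ) (σ : ℝ) (ε : EuclideanSpace ℝ (Fin n)) : EuclideanSpace ℝ (Fin n) :=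
  WithLp.toLp 2 (D.X *ᵥ β) + σ • ε

theorem law_eq_map_response (β : Fin p → ℝ) {σ : ℝ} (hσ : 0 < σ) :
    D.law β σ = (stdGaussian (EuclideanSpace ℝ (Fin n))).map (D.response β σ) := by
  have h : CFC.sqrt (σ ^ 2 • (1 : Matrix (Fin n) (Fin n) ℝ)) = σ • 1 := by
    rw [CFC.sqrt_eq_iff _ _ ?_ ?_]
    · rw [smul_mul_smul_comm, one_mul, sq]
    · exact (Matrix.PosSemidef.one.smul (sq_nonneg σ)).nonneg
    · exact (Matrix.PosSemidef.one.smul hσ.le).nonneg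
  rw [law, multivariateGaussian, h]
  congr 1
  ext1 ε
  simp [response]

/-- The standardized error of `τ̂`. -/
def errTau (ε : EuclideanSpace ℝ (Fin n)) : EuclideanSpace ℝ (Fin s) :=
  WithLp.toLp 2 (D.errMatrix *ᵥ ε.ofLp)

variable (β : Fin p → ℝ) {σ : ℝ} (ε : EuclideanSpace ℝ (Fin n))

theorem βhat_response :
    D.βhat (D.response β σ ε) = β + σ • (D.gram⁻¹ *ᵥ (D.Xᵀ *ᵥ ε.ofLp)) := by
  have h : D.gram⁻¹ *ᵥ (D.Xᵀ *ᵥ (D.X *ᵥ β)) = β := by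
    rw [mulVec_mulVec β D.Xᵀ]
    change D.gram⁻¹ *ᵥ D.gram *ᵥ β = β
    rw [mulVec_mulVec, Matrix.nonsing_inv_mul _ D.isUnit_det_gram, one_mulVec]
  simp only [βhat, response, WithLp.ofLp_add, WithLp.ofLp_smul, mulVec_add, mulVec_smul, h]

theorem V₂₂invSqrt_mulVec_τhat_response (hσ : 0 < σ) :
    D.V₂₂invSqrt *ᵥ D.τhat (D.response β σ ε) = σ • (D.γ β σ + D.errTau ε).ofLp := by
  have h1 : D.τhat (D.response β σ ε) =
      D.τ β + σ • (D.Cᵀ *ᵥ (D.gram⁻¹ *ᵥ (D.Xᵀ *ᵥ ε.ofLp))) := by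
    rw [τhat, βhat_response, τ, τ, mulVec_add, mulVec_smul]
    abel
  rw [h1, mulVec_add, mulVec_smul, WithLp.ofLp_add, smul_add, γ, errTau, errMatrix]
  simp only [mulVec_mulVec, smul_smul, mul_inv_cancel₀ hσ.ne', one_smul]

theorem τhat_quadForm (hσ : 0 < σ) :
    D.τhat (D.response β σ ε) ⬝ᵥ (D.V₂₂⁻¹ *ᵥ D.τhat (D.response β σ ε)) =
      σ ^ 2 * ‖D.γ β σ + D.errTau ε‖ ^ 2 := by
  rw [dotProduct_V_inv_mulVec, V₂₂invSqrt_mulVec_τhat_response _ _ _ hσ, smul_dotProduct,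
    dotProduct_smul, EuclideanSpace.real_norm_sq_eq]
  simp [dotProduct, sq, mul_assoc]

/-- β̂ - β* is the image of V₂₂⁻¹τ̂ under gram⁻¹C, and that map pulls the Gram form back to V₂₂.
With `τhat_quadForm`, the numerator of F depends on the noise through ‖γ + h‖ alone. -/
theorem βhat_sub_βstar_quadForm (y : EuclideanSpace ℝ (Fin n)) :
    (D.βhat y - D.βstar y) ⬝ᵥ (D.gram *ᵥ (D.βhat y - D.βstar y)) =
      D.τhat y ⬝ᵥ (D.V₂₂⁻¹ *ᵥ D.τhat y) := by
  have h : D.βhat y - D.βstar y = D.gram⁻¹ *ᵥ (D.C *ᵥ (D.V₂₂⁻¹ *ᵥ D.τhat y)) := by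
    rw [βstar]; abel
  rw [h, mulVec_mulVec _ D.gram, Matrix.mul_nonsing_inv _ D.isUnit_det_gram, one_mulVec]
  have h2 : ∀ x : Fin s → ℝ, (D.gram⁻¹ *ᵥ (D.C *ᵥ x)) ⬝ᵥ (D.C *ᵥ x) = x ⬝ᵥ (D.V₂₂ *ᵥ x) := by
    intro x
    rw [dotProduct_mulVec, ← mulVec_transpose, mulVec_mulVec, mulVec_mulVec, dotProduct_comm, V₂₂]
  rw [h2, mulVec_mulVec, Matrix.mul_nonsing_inv _ D.isUnit_det_V, one_mulVec, dotProduct_comm]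

theorem R_βstar (y : EuclideanSpace ℝ (Fin n)) :
    D.R y (D.βstar y) = D.R y (D.βhat y) + D.τhat y ⬝ᵥ (D.V₂₂⁻¹ *ᵥ D.τhat y) := by
  rw [R_eq, ← βhat_sub_βstar_quadForm, ← neg_sub (D.βhat y) (D.βstar y), mulVec_neg,
    neg_dotProduct_neg]

theorem ofLp_dotProduct {k : ℕ} (x y : EuclideanSpace ℝ (Fin k)) :
    x.ofLp ⬝ᵥ y.ofLp = inner ℝ x y := by
  simp [PiLp.inner_apply, dotProduct, mul_comm]

theorem sqrt_v₁₁_smul_b : √D.v₁₁ • D.b.ofLp = D.V₂₂invSqrt *ᵥ D.v₂₁ := by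
  rw [b, smul_smul, mul_inv_cancel₀ (Real.sqrt_pos.2 D.v₁₁_pos).ne', one_smul]

theorem Θhat_response :
    D.Θhat (D.response β σ ε) - D.θ β =
      σ * √D.v₁₁ * (D.residDir ⬝ᵥ ε.ofLp + inner ℝ D.b (D.errTau ε)) := by
  have hv := Real.sqrt_pos.2 D.v₁₁_pos
  have h1 : D.residDir ⬝ᵥ ε.ofLp + inner ℝ D.b (D.errTau ε) =
      (√D.v₁₁)⁻¹ * (D.a ⬝ᵥ (D.gram⁻¹ *ᵥ (D.Xᵀ *ᵥ ε.ofLp))) := by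
    rw [residDir, sub_dotProduct, smul_dotProduct, X_mulVec_dotProduct, gram_inv_mulVec_dotProduct,
      mulVec_transpose D.errMatrix, ← dotProduct_mulVec, ← ofLp_dotProduct, errTau, smul_eq_mul]
    ring
  rw [h1, Θhat, θ, βhat_response, dotProduct_add, dotProduct_smul, smul_eq_mul]
  field_simp
  ring

/-- The restriction subtracts σ√v₁₁ bᵀ(γ + h) from Θ̂. The random part bᵀh cancels and only the bias
-bᵀγ remains, so Θ* no longer involves the error of τ̂. -/
theorem Θstar_response (hσ : 0 < σ) :
    D.Θstar (D.response β σ ε) - D.θ β =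
      σ * √D.v₁₁ * (D.residDir ⬝ᵥ ε.ofLp - inner ℝ D.b (D.γ β σ)) := by
  have h1 : D.Θstar (D.response β σ ε) = D.Θhat (D.response β σ ε) -
      σ * √D.v₁₁ * inner ℝ D.b (D.γ β σ + D.errTau ε) := by
    have h2 : D.a ⬝ᵥ (D.gram⁻¹ *ᵥ (D.C *ᵥ (D.V₂₂⁻¹ *ᵥ D.τhat (D.response β σ ε)))) =
        D.v₂₁ ⬝ᵥ (D.V₂₂⁻¹ *ᵥ D.τhat (D.response β σ ε)) := by
      rw [← gram_inv_mulVec_dotProduct, dotProduct_mulVec, ← mulVec_transpose, v₂₁]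
    rw [Θstar, βstar, dotProduct_sub, h2, dotProduct_V_inv_mulVec,
      V₂₂invSqrt_mulVec_τhat_response _ _ _ hσ, ← sqrt_v₁₁_smul_b, smul_dotProduct, dotProduct_smul,
      ofLp_dotProduct, Θhat, smul_eq_mul, smul_eq_mul]
    ring
  have h3 := D.Θhat_response β ε (σ := σ)
  rw [h1, inner_add_right]
  linear_combination h3

theorem v₁₁_sub : D.v₁₁ - D.v₂₁ ⬝ᵥ (D.V₂₂⁻¹ *ᵥ D.v₂₁) = D.v₁₁ * (1 - ‖D.b‖ ^ 2) := by
  rw [dotProduct_V_inv_mulVec, ← sqrt_v₁₁_smul_b, smul_dotProduct, dotProduct_smul,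
    b_dotProduct_self, smul_eq_mul, smul_eq_mul, ← mul_assoc, Real.mul_self_sqrt D.v₁₁_pos.le]
  ring

/-- The column space of the design matrix. -/
def colSpace : Submodule ℝ (EuclideanSpace ℝ (Fin n)) :=
  LinearMap.range ((WithLp.linearEquiv 2 ℝ (Fin n → ℝ)).symm.toLinearMap ∘ₗ D.X.mulVecLin)

theorem mem_colSpace (x : Fin p → ℝ) : WithLp.toLp 2 (D.X *ᵥ x) ∈ D.colSpace := ⟨x, by simp⟩

theorem finrank_colSpace_orthogonal {m : ℕ} (hn : n = p + m) :
    Module.finrank ℝ D.colSpaceᗮ = m := by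
  have h1 := Submodule.finrank_add_finrank_orthogonal D.colSpace
  have h2 : Module.finrank ℝ D.colSpace = p := by
    rw [colSpace, LinearMap.finrank_range_of_inj]
    · simp
    · have := Matrix.mulVec_injective_iff.2 D.linearIndependent_X
      exact (WithLp.linearEquiv 2 ℝ (Fin n → ℝ)).symm.injective.comp this
  have h3 : Module.finrank ℝ (EuclideanSpace ℝ (Fin n)) = n := by simp
  omega

/-- The residual sum of squares in coordinates of the orthogonal complement. -/
theorem R_βhat_response {m : ℕ} (f : OrthonormalBasis (Fin m) ℝ D.colSpaceᗮ) :
    D.R (D.response β σ ε) (D.βhat (D.response β σ ε)) =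
      σ ^ 2 * ∑ j, inner ℝ (f j : EuclideanSpace ℝ (Fin n)) ε ^ 2 := by
  set y := D.response β σ ε with hy
  let e : EuclideanSpace ℝ (Fin n) := y - WithLp.toLp 2 (D.X *ᵥ D.βhat y)
  have h0 : D.Xᵀ *ᵥ (y.ofLp - D.X *ᵥ D.βhat y) = 0 := by
    have : D.gram *ᵥ D.βhat y = D.Xᵀ *ᵥ y.ofLp := by
      unfold βhat
      rw [mulVec_mulVec, Matrix.mul_nonsing_inv _ D.isUnit_det_gram, one_mulVec]
    rw [mulVec_sub, mulVec_mulVec, ← this]; simp [gram]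
  -- The normal equations make the residual vector orthogonal to the column space. Its coordinates
  -- along f then see only σε, since Xβ and Xβ̂ have none.
  have he : e ∈ D.colSpaceᗮ := by
    rw [Submodule.mem_orthogonal]
    rintro _ ⟨x, rfl⟩
    rw [← ofLp_dotProduct]
    change (D.X *ᵥ x) ⬝ᵥ (y.ofLp - D.X *ᵥ D.βhat y) = 0
    rw [X_mulVec_dotProduct, h0, dotProduct_zero]
  have h1 : D.R y (D.βhat y) = ‖e‖ ^ 2 := by
    rw [← real_inner_self_eq_norm_sq, ← ofLp_dotProduct]
    rfl
  have h2 : ‖e‖ ^ 2 = ∑ j, inner ℝ (f j : EuclideanSpace ℝ (Fin n)) e ^ 2 := by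
    have := f.sum_sq_inner_right ⟨e, he⟩
    simpa using this.symm
  have h3 : ∀ j, inner ℝ (f j : EuclideanSpace ℝ (Fin n)) e =
      σ * inner ℝ (f j : EuclideanSpace ℝ (Fin n)) ε := by
    intro j
    have h4 : ∀ x, inner ℝ (f j : EuclideanSpace ℝ (Fin n)) (WithLp.toLp 2 (D.X *ᵥ x)) = 0 :=
      fun x => Submodule.inner_left_of_mem_orthogonal (D.mem_colSpace x) (f j).2
    simp only [e, hy, response, inner_sub_right, inner_add_right, h4, inner_smul_right]
    ring
  rw [h1, h2, Finset.mul_sum]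
  refine Finset.sum_congr rfl fun j _ => ?_
  rw [h3]
  ring

/-- The rows of `errMatrix`, the normalized `residDir` and an orthonormal basis of the residual
space form an orthonormal family. -/
theorem orthonormal_blocks {m : ℕ} (f : OrthonormalBasis (Fin m) ℝ D.colSpaceᗮ) :
    Orthonormal ℝ (Sum.elim (Sum.elim
      (fun i => (WithLp.toLp 2 (D.errMatrix i) : EuclideanSpace ℝ (Fin n)))
      fun j => (f j : EuclideanSpace ℝ (Fin n)))
      fun _ : Unit =>
        (√(1 - ‖D.b‖ ^ 2))⁻¹ • (WithLp.toLp 2 D.residDir : EuclideanSpace ℝ (Fin n))) := by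
  have hb := D.one_sub_norm_b_sq_pos
  have hb' := Real.sqrt_pos.2 hb
  -- Membership of the rows, and of `residDir`, in the column space makes them orthogonal to f.
  have hrow : ∀ i, WithLp.toLp 2 (D.errMatrix i) ∈ D.colSpace := by
    intro i
    have : D.errMatrix i = D.errMatrixᵀ *ᵥ Pi.single i 1 := by
      ext j
      simp
    rw [this, errMatrix_transpose, ← mulVec_mulVec]
    exact D.mem_colSpace _
  have hres : WithLp.toLp 2 D.residDir ∈ D.colSpace := by
    rw [residDir_eq]
    exact D.mem_colSpace _
  have huu : ∀ i j, inner ℝ (WithLp.toLp 2 (D.errMatrix i) : EuclideanSpace ℝ (Fin n))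
      (WithLp.toLp 2 (D.errMatrix j)) = if i = j then 1 else 0 := by
    intro i j
    have h := congrFun (congrFun D.errMatrix_mul_transpose i) j
    rw [Matrix.one_apply] at h
    rw [← h, ← ofLp_dotProduct]
    rfl
  have hue : ∀ i, inner ℝ (WithLp.toLp 2 (D.errMatrix i) : EuclideanSpace ℝ (Fin n))
      (WithLp.toLp 2 D.residDir) = 0 := by
    intro i
    have h := congrFun D.errMatrix_mulVec_residDir i
    rw [← ofLp_dotProduct]
    exact h
  have hee : inner ℝ (WithLp.toLp 2 D.residDir : EuclideanSpace ℝ (Fin n))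
      (WithLp.toLp 2 D.residDir) = 1 - ‖D.b‖ ^ 2 := by
    rw [← ofLp_dotProduct, ← residDir_dotProduct_self]
  have hff := orthonormal_iff_ite.1 f.orthonormal
  have hSf : ∀ x ∈ D.colSpace, ∀ j, inner ℝ x (f j : EuclideanSpace ℝ (Fin n)) = 0 :=
    fun x hx j => Submodule.inner_right_of_mem_orthogonal hx (f j).2
  rw [orthonormal_iff_ite]
  rintro ((i | i) | i) ((j | j) | j)
  · simpa using huu i j
  · simpa using hSf _ (hrow i) j
  · simp [inner_smul_right, hue]
  · simpa [real_inner_comm] using hSf _ (hrow j) i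
  · simpa using hff i j
  · simp [inner_smul_right, real_inner_comm, hSf _ hres i]
  · simp [inner_smul_left, real_inner_comm, hue]
  · simp [inner_smul_left, hSf _ hres j]
  · simp only [Sum.elim_inr, inner_smul_left, inner_smul_right, hee, conj_trivial, if_true]
    rw [← mul_assoc, ← mul_inv, Real.mul_self_sqrt hb.le, inv_mul_cancel₀ hb.ne']

/-- The joint law of the standardized statistics. -/
theorem stdGaussian_map_statistics {m : ℕ} (hn : n = p + m) (hσ : 0 < σ) :
    (stdGaussian (EuclideanSpace ℝ (Fin n))).map (fun ε =>
      ((D.errTau ε, D.W (D.response β σ ε) m σ), D.residDir ⬝ᵥ ε.ofLp)) =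
      ((stdGaussian (EuclideanSpace ℝ (Fin s))).prod (scaledChiLaw m)).prod
        (gaussianReal 0 (1 - ‖D.b‖ ^ 2).toNNReal) := by
  have hb := D.one_sub_norm_b_sq_pos
  have hb' := Real.sqrt_pos.2 hb
  let f := (stdOrthonormalBasis ℝ D.colSpaceᗮ).reindex
    (finCongr (D.finrank_colSpace_orthogonal hn))
  have h := stdGaussian_map_three_blocks (D.orthonormal_blocks f)
  -- The third block was normalized to unit length; undoing this restores the variance 1 - ‖b‖².
  have hg : (gaussianReal 0 1).map (fun x => √(1 - ‖D.b‖ ^ 2) * x) =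
      gaussianReal 0 (1 - ‖D.b‖ ^ 2).toNNReal := by
    rw [gaussianReal_map_const_mul]
    congr 1
    · simp
    · ext
      simp [Real.sq_sqrt hb.le, hb.le]
  have hw : scaledChiLaw m = (stdGaussian (EuclideanSpace ℝ (Fin m))).map
      fun z => √((∑ j, z j ^ 2) / m) := by
    rw [scaledChiLaw, chiSquared, Measure.map_map (by fun_prop) (by fun_prop)]
    rfl
  have h1 := Measure.map_prod_map (stdGaussian (EuclideanSpace ℝ (Fin s)))
    (stdGaussian (EuclideanSpace ℝ (Fin m)))
    measurable_id (g := fun z => √((∑ j, z j ^ 2) / m)) (by fun_prop)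
  rw [Measure.map_id] at h1
  rw [← hg, hw, h1, Measure.map_prod_map _ _ (by fun_prop) (by fun_prop), ← h,
    Measure.map_map (by fun_prop) (by fun_prop)]
  congr 1
  ext1 ε
  simp only [Function.comp_apply, Prod.map_apply, id_eq]
  congr 1
  · congr 1
    · ext i
      simp only [errTau, mulVec, ← ofLp_dotProduct]
    · rw [W, sigmaHat, R_βhat_response _ _ _ f, mul_div_assoc, Real.sqrt_mul (sq_nonneg σ),
        Real.sqrt_sq hσ.le, mul_div_cancel_left₀ _ hσ.ne']
  · rw [real_inner_smul_left, mul_inv_cancel_left₀ hb'.ne', ← ofLp_dotProduct]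

end Regression

/-! ### Integrals against the densities and the conditional probability on rejection -/

theorem setIntegral_eq_setIntegral_mul_density {μ : Measure ℝ} [IsProbabilityMeasure μ]
    (hμ : μ ≪ volume) {S : Set ℝ} (hS : MeasurableSet S) (G : ℝ → ℝ) :
    ∫ x in S, G x ∂μ = ∫ x in S, G x * density μ x := by
  rw [← integral_indicator hS, ← integral_rnDeriv_smul hμ, ← integral_indicator hS]
  refine integral_congr_ae (Filter.Eventually.of_forall fun x => ?_)
  by_cases hx : x ∈ S
  · simp [hx, density, mul_comm]
  · simp [hx]

theorem integral_angleLaw (k : ℕ) (G : ℝ → ℝ) :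
    ∫ t, G t ∂angleLaw (k + 2) = ∫ t in (0 : ℝ)..1, G t * fT₁ (k + 2) t := by
  have hpos : ∀ t, 0 ≤ fT₁ (k + 2) t := by
    intro t
    unfold fT₁
    split_ifs with h
    · have hs : 0 ≤ Real.sin (Real.pi * t) := Real.sin_nonneg_of_nonneg_of_le_pi
        (mul_nonneg Real.pi_pos.le h.1) (by nlinarith [Real.pi_pos])
      have hb := beta_half_pos k
      have : (((k + 2 : ℕ) : ℝ) - 1) / 2 = ((k : ℝ) + 1) / 2 := by push_cast; ring
      rw [this]
      have := Real.pi_pos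
      positivity
    · exact le_rfl
  rw [angleLaw, integral_withDensity_eq_integral_toReal_smul
    (measurable_fT₁ _).ennreal_ofReal (by simp), intervalIntegral.integral_of_le zero_le_one,
    ← integral_Icc_eq_integral_Ioc, ← integral_indicator measurableSet_Icc]
  congr 1
  ext t
  rw [ENNReal.toReal_ofReal (hpos t), smul_eq_mul, mul_comm]
  by_cases ht : t ∈ Set.Icc (0 : ℝ) 1
  · rw [Set.indicator_of_mem ht]
  · rw [Set.indicator_of_notMem ht, fT₁, if_neg (show ¬(0 ≤ t ∧ t ≤ 1) from ht), mul_zero]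

/-- The second angle is the first angle of the tail, a vector in one dimension less. -/
theorem fT₂_eq (k : ℕ) : fT₂ (k + 3) = fT₁ (k + 2) := by
  ext t
  have : (((k + 3 : ℕ) : ℝ) - 2) / 2 = (((k + 2 : ℕ) : ℝ) - 1) / 2 := by push_cast; ring
  simp only [fT₂, fT₁, this]
  rfl

theorem fT₁_two_eq_one {t : ℝ} (ht : t ∈ Set.Icc (0 : ℝ) 1) : fT₁ 2 t = 1 := by
  have h := integral_sin_pow_eq_beta 0
  simp only [pow_zero, intervalIntegral.integral_const, sub_zero, smul_eq_mul, mul_one] at h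
  have h2 : (((2 : ℕ) : ℝ) - 1) / 2 = (((0 : ℕ) : ℝ) + 1) / 2 := by norm_num
  rw [fT₁, if_pos (show 0 ≤ t ∧ t ≤ 1 from ht), h2, ← h]
  simp [Real.pi_ne_zero]

theorem integral_angleLaw_two (G : ℝ → ℝ) :
    ∫ t, G t ∂angleLaw 2 = ∫ t in (0 : ℝ)..1, G t := by
  rw [integral_angleLaw 0]
  refine intervalIntegral.integral_congr fun t ht => ?_
  rw [Set.uIcc_of_le zero_le_one] at ht
  simp only [zero_add, fT₁_two_eq_one ht, mul_one]

theorem integral_chiLaw (k : ℕ) (G : ℝ → ℝ) :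
    ∫ r, G r ∂chiLaw (k + 2) = ∫ r in Set.Ioi (0 : ℝ), G r * fR (k + 2) r := by
  have := isProbabilityMeasure_chiLaw (k + 2)
  rw [fR, ← setIntegral_eq_setIntegral_mul_density (chiLaw_absolutelyContinuous (by omega))
    measurableSet_Ioi, Measure.restrict_eq_self_of_ae_mem (s := Set.Ioi 0) (ae_pos_chiLaw k)]

theorem integral_scaledChiLaw {m : ℕ} (hm : 0 < m) (G : ℝ → ℝ) :
    ∫ w, G w ∂scaledChiLaw m = ∫ w in Set.Ioi (0 : ℝ), G w * density (scaledChiLaw m) w := by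
  have := isProbabilityMeasure_scaledChiLaw m
  rw [← setIntegral_eq_setIntegral_mul_density (scaledChiLaw_absolutelyContinuous hm)
    measurableSet_Ioi, Measure.restrict_eq_self_of_ae_mem (s := Set.Ioi 0) (ae_pos_scaledChiLaw hm)]

theorem measurable_measureReal_Icc (μ : Measure ℝ) [IsProbabilityMeasure μ] {X : Type*}
    [MeasurableSpace X] {f g : X → ℝ} (hf : Measurable f) (hg : Measurable g) :
    Measurable fun x => μ.real (Set.Icc (f x) (g x)) := by
  have hS : MeasurableSet {p : X × ℝ | f p.1 ≤ p.2 ∧ p.2 ≤ g p.1} :=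
    MeasurableSet.inter (s₁ := {p : X × ℝ | f p.1 ≤ p.2}) (s₂ := {p : X × ℝ | p.2 ≤ g p.1})
      (measurableSet_le (by fun_prop) (by fun_prop)) (measurableSet_le (by fun_prop) (by fun_prop))
  exact (measurable_measure_prodMk_left (ν := μ) hS).ennreal_toReal

theorem measurable_iProb (α : ℝ) (m : ℕ) (B : ℝ) {X : Type*} [MeasurableSpace X] {f g : X → ℝ}
    (hf : Measurable f) (hg : Measurable g) : Measurable fun x => iProb α m B (f x) (g x) :=
  measurable_measureReal_Icc _ (by fun_prop) (by fun_prop)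

theorem measurable_jProb (α : ℝ) (m s : ℕ) (B x : ℝ) {X : Type*} [MeasurableSpace X] {f g : X → ℝ}
    (hf : Measurable f) (hg : Measurable g) : Measurable fun z => jProb α m s B x (f z) (g z) :=
  measurable_measureReal_Icc _ (by fun_prop) (by fun_prop)

theorem iProb_nonneg (α : ℝ) (m : ℕ) (B x w : ℝ) : 0 ≤ iProb α m B x w := measureReal_nonneg

theorem iProb_le_one (α : ℝ) (m : ℕ) (B x w : ℝ) : iProb α m B x w ≤ 1 := measureReal_le_one

theorem jProb_nonneg (α : ℝ) (m s : ℕ) (B x y w : ℝ) : 0 ≤ jProb α m s B x y w :=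
  measureReal_nonneg

theorem jProb_le_one (α : ℝ) (m s : ℕ) (B x y w : ℝ) : jProb α m s B x y w ≤ 1 :=
  measureReal_le_one

theorem iProb_neg (α : ℝ) (m : ℕ) (B x w : ℝ) : iProb α m B (-x) w = iProb α m B x w := by
  have h := gaussianReal_map_neg (μ := 0) (v := (1 - B ^ 2).toNNReal)
  rw [neg_zero] at h
  rw [iProb, ← h, map_measureReal_apply (by fun_prop) measurableSet_Icc, iProb]
  congr 1
  ext z
  simp only [Set.mem_preimage, Set.mem_Icc]
  constructor <;> rintro ⟨h1, h2⟩ <;> constructor <;> linarith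

/-- The conditional probability of `θ ∈ I` and `F > ℓ` given the squared norm `d` of the
standardized estimator of `τ` and the shift `x`. -/
def rejectCover (m s : ℕ) (α ℓ B d x : ℝ) : ℝ :=
  ∫ w, (if s * ℓ * w ^ 2 < d then iProb α m B x w else 0) ∂scaledChiLaw m

theorem measurable_ite_iProb (m s : ℕ) (α ℓ B : ℝ) {X : Type*} [MeasurableSpace X]
    {d x w : X → ℝ} (hd : Measurable d) (hx : Measurable x) (hw : Measurable w) :
    Measurable fun z => if s * ℓ * w z ^ 2 < d z then iProb α m B (x z) (w z) else 0 :=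
  Measurable.ite (measurableSet_lt (by fun_prop) hd) (measurable_iProb α m B hx hw)
    measurable_const

theorem norm_ite_iProb_le (m s : ℕ) (α ℓ B d x w : ℝ) :
    ‖if s * ℓ * w ^ 2 < d then iProb α m B x w else 0‖ ≤ 1 := by
  split_ifs
  · rw [Real.norm_of_nonneg (iProb_nonneg ..)]
    exact iProb_le_one ..
  · simp

theorem measurable_rejectCover (m s : ℕ) (α ℓ B : ℝ) {X : Type*} [MeasurableSpace X]
    {d x : X → ℝ} (hd : Measurable d) (hx : Measurable x) :
    Measurable fun z => rejectCover m s α ℓ B (d z) (x z) := by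
  have := isProbabilityMeasure_scaledChiLaw m
  have h : Measurable fun q : X × ℝ =>
      if s * ℓ * q.2 ^ 2 < d q.1 then iProb α m B (x q.1) q.2 else 0 :=
    measurable_ite_iProb m s α ℓ B (by fun_prop) (by fun_prop) (by fun_prop)
  exact (h.stronglyMeasurable.integral_prod_right (ν := scaledChiLaw m)).measurable

theorem norm_rejectCover_le (m s : ℕ) (α ℓ B d x : ℝ) : ‖rejectCover m s α ℓ B d x‖ ≤ 1 := by
  have := isProbabilityMeasure_scaledChiLaw m
  have h := norm_integral_le_of_norm_le_const (μ := scaledChiLaw m) (C := 1)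
    (Filter.Eventually.of_forall fun w => norm_ite_iProb_le m s α ℓ B d x w)
  simpa [rejectCover] using h

theorem integrable_rejectCover (m s : ℕ) (α ℓ B : ℝ) {X : Type*} [MeasurableSpace X]
    (μ : Measure X) [IsProbabilityMeasure μ] {d x : X → ℝ} (hd : Measurable d)
    (hx : Measurable x) : Integrable (fun z => rejectCover m s α ℓ B (d z) (x z)) μ :=
  Integrable.of_bound (measurable_rejectCover m s α ℓ B hd hx).aestronglyMeasurable 1
    (Filter.Eventually.of_forall fun _ => norm_rejectCover_le ..)

/-- Symmetry of the centred normal law of Z. It makes the cases ψ = -1 and ψ = 1 agree. -/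
theorem rejectCover_neg (m s : ℕ) (α ℓ B d x : ℝ) :
    rejectCover m s α ℓ B d (-x) = rejectCover m s α ℓ B d x := by
  simp only [rejectCover, iProb_neg]

/-- For w > 0, rejection means w < √(d/(sℓ)), which is the upper limit u. A nonpositive d gives an
empty range on both sides, the square root then being 0. -/
theorem rejectCover_eq_intervalIntegral {m s : ℕ} (hm : 0 < m) (hs : 0 < s) {ℓ : ℝ} (hℓ : 0 < ℓ)
    (α B d x : ℝ) :
    rejectCover m s α ℓ B d x = ∫ w in (0 : ℝ)..√(d / (s * ℓ)),
      iProb α m B x w * density (scaledChiLaw m) w := by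
  have := isProbabilityMeasure_scaledChiLaw m
  have hsl : (0 : ℝ) < s * ℓ := by positivity
  rw [intervalIntegral.integral_of_le (Real.sqrt_nonneg _), integral_Ioc_eq_integral_Ioo,
    ← setIntegral_eq_setIntegral_mul_density (scaledChiLaw_absolutelyContinuous hm)
      measurableSet_Ioo, ← integral_indicator measurableSet_Ioo, rejectCover]
  refine integral_congr_ae ?_
  filter_upwards [ae_pos_scaledChiLaw hm] with w hw
  have hiff : s * ℓ * w ^ 2 < d ↔ w ∈ Set.Ioo 0 √(d / (s * ℓ)) := by
    simp only [Set.mem_Ioo, hw, true_and, Real.lt_sqrt hw.le, lt_div_iff₀ hsl]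
    rw [mul_comm]
  by_cases h : s * ℓ * w ^ 2 < d
  · rw [if_pos h, Set.indicator_of_mem (hiff.1 h)]
  · rw [if_neg h, Set.indicator_of_notMem fun h' => h (hiff.2 h')]

/-- Integration of a bounded function of the first coordinates and the norm, in dimension two. -/
theorem integral_rejectCover_two (m : ℕ) (α ℓ B g ψ : ℝ) :
    ∫ h, rejectCover m 2 α ℓ B (g ^ 2 + 2 * g * h 0 + ‖h‖ ^ 2)
      (-(B * (ψ * h 0 + √(1 - ψ ^ 2) * h 1))) ∂stdGaussian (EuclideanSpace ℝ (Fin 2)) =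
    ∫ t in (0 : ℝ)..1, ∫ r in Set.Ioi (0 : ℝ),
      rejectCover m 2 α ℓ B (dFun 2 g t r) (-B * r * kTwo ψ t) * fR 2 r := by
  have := isProbabilityMeasure_angleLaw 0
  have := isProbabilityMeasure_chiLaw 2
  have h1 : ∀ h : EuclideanSpace ℝ (Fin 2), ‖h‖ ^ 2 = h 0 ^ 2 + h 1 ^ 2 := by
    intro h
    simp [EuclideanSpace.real_norm_sq_eq]
  have h2 := integral_map (μ := stdGaussian (EuclideanSpace ℝ (Fin 2)))
    (φ := fun h => (h 0, h 1)) (by fun_prop)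
    (f := fun q : ℝ × ℝ => rejectCover m 2 α ℓ B (g ^ 2 + 2 * g * q.1 + (q.1 ^ 2 + q.2 ^ 2))
      (-(B * (ψ * q.1 + √(1 - ψ ^ 2) * q.2))))
    (measurable_rejectCover m 2 α ℓ B (by fun_prop) (by fun_prop)).aestronglyMeasurable
  simp only [h1]
  rw [← h2, stdGaussian_fin_two_polar, integral_map (by fun_prop)
    (measurable_rejectCover m 2 α ℓ B (by fun_prop) (by fun_prop)).aestronglyMeasurable,
    integral_prod_symm _ (integrable_rejectCover m 2 α ℓ B _ (by fun_prop) (by fun_prop)),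
    integral_angleLaw_two]
  refine intervalIntegral.integral_congr fun t _ => ?_
  simp only
  rw [integral_chiLaw 0]
  refine setIntegral_congr_fun measurableSet_Ioi fun r _ => ?_
  simp only [zero_add]
  congr 2
  · rw [dFun, if_pos rfl]
    linear_combination r ^ 2 * Real.sin_sq_add_cos_sq (2 * Real.pi * t)
  · rw [kTwo]
    ring

theorem integral_rejectCover_of_three_le (m k : ℕ) (α ℓ B g ψ : ℝ) :
    ∫ h, rejectCover m (k + 3) α ℓ B (g ^ 2 + 2 * g * h 0 + ‖h‖ ^ 2)
      (-(B * (ψ * h 0 + √(1 - ψ ^ 2) * h 1))) ∂stdGaussian (EuclideanSpace ℝ (Fin (k + 3))) =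
    ∫ t₂ in (0 : ℝ)..1, ∫ t₁ in (0 : ℝ)..1, ∫ r in Set.Ioi (0 : ℝ),
      rejectCover m (k + 3) α ℓ B (dFun (k + 3) g t₁ r) (-B * r * kFun (k + 3) ψ t₁ t₂)
        * fR (k + 3) r * fT₁ (k + 3) t₁ * fT₂ (k + 3) t₂ := by
  have := isProbabilityMeasure_angleLaw k
  have := isProbabilityMeasure_angleLaw (k + 1)
  have := isProbabilityMeasure_chiLaw (k + 3)
  have hm := measurable_axisCos (k + 2)
  have h2 := integral_map (μ := stdGaussian (EuclideanSpace ℝ (Fin (k + 3))))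
    (φ := fun h => ((h 0, h 1), ‖h‖)) (by fun_prop)
    (f := fun q : (ℝ × ℝ) × ℝ => rejectCover m (k + 3) α ℓ B (g ^ 2 + 2 * g * q.1.1 + q.2 ^ 2)
      (-(B * (ψ * q.1.1 + √(1 - ψ ^ 2) * q.1.2))))
    (measurable_rejectCover m (k + 3) α ℓ B (by fun_prop) (by fun_prop)).aestronglyMeasurable
  simp only at h2
  rw [← h2, stdGaussian_map_two_heads_norm, integral_map (by fun_prop)
    (measurable_rejectCover m (k + 3) α ℓ B (by fun_prop) (by fun_prop)).aestronglyMeasurable,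
    integral_prod_symm _ (integrable_rejectCover m (k + 3) α ℓ B _ (by fun_prop) (by fun_prop)),
    integral_angleLaw]
  refine intervalIntegral.integral_congr fun t₂ _ => ?_
  simp only
  rw [integral_prod_symm _ (integrable_rejectCover m (k + 3) α ℓ B _ (by fun_prop) (by fun_prop)),
    integral_angleLaw (k + 1), fT₂_eq, ← intervalIntegral.integral_mul_const]
  refine intervalIntegral.integral_congr fun t₁ _ => ?_
  simp only
  rw [integral_chiLaw (k + 1), ← integral_mul_const, ← integral_mul_const]
  refine setIntegral_congr_fun measurableSet_Ioi fun r _ => ?_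
  congr 4
  · rw [dFun, if_neg (by omega)]
    ring
  · by_cases hk : k = 0
    · rw [kFun, if_pos (by omega), axisCos, if_pos (by omega)]
      ring
    · rw [kFun, if_neg (by omega), axisCos, if_neg (by omega)]
      ring

/-- When b and γ are parallel the second coordinate drops out and one angle suffices. This serves ψ
= ±1 and also γ = 0. -/
theorem integral_rejectCover_axis (m k : ℕ) (α ℓ B g : ℝ) :
    ∫ h, rejectCover m (k + 3) α ℓ B (g ^ 2 + 2 * g * h 0 + ‖h‖ ^ 2) (-(B * h 0))
      ∂stdGaussian (EuclideanSpace ℝ (Fin (k + 3))) =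
    ∫ t₁ in (0 : ℝ)..1, ∫ r in Set.Ioi (0 : ℝ),
      rejectCover m (k + 3) α ℓ B (dFun (k + 3) g t₁ r) (-B * r * Real.cos (Real.pi * t₁))
        * fR (k + 3) r * fT₁ (k + 3) t₁ := by
  have := isProbabilityMeasure_angleLaw (k + 1)
  have := isProbabilityMeasure_chiLaw (k + 3)
  have hm := measurable_axisCos (k + 3)
  have h2 := integral_map (μ := stdGaussian (EuclideanSpace ℝ (Fin (k + 3))))
    (φ := fun h => (h 0, ‖h‖)) (by fun_prop)
    (f := fun q : ℝ × ℝ => rejectCover m (k + 3) α ℓ B (g ^ 2 + 2 * g * q.1 + q.2 ^ 2)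
      (-(B * q.1)))
    (measurable_rejectCover m (k + 3) α ℓ B (by fun_prop) (by fun_prop)).aestronglyMeasurable
  simp only at h2
  rw [← h2, stdGaussian_map_head_norm (k + 1), integral_map (by fun_prop)
    (measurable_rejectCover m (k + 3) α ℓ B (by fun_prop) (by fun_prop)).aestronglyMeasurable,
    integral_prod_symm _ (integrable_rejectCover m (k + 3) α ℓ B _ (by fun_prop) (by fun_prop)),
    integral_angleLaw (k + 1)]
  refine intervalIntegral.integral_congr fun t₁ _ => ?_
  simp only
  rw [integral_chiLaw (k + 1), ← integral_mul_const]
  refine setIntegral_congr_fun measurableSet_Ioi fun r _ => ?_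
  congr 3
  · rw [dFun, if_neg (by omega), axisCos, if_neg (by omega)]
    ring
  · rw [axisCos, if_neg (by omega)]
    ring

theorem measureReal_prod_eq_integral {X Y : Type*} [MeasurableSpace X] [MeasurableSpace Y]
    (μ : Measure X) (ν : Measure Y) [IsProbabilityMeasure μ] [IsProbabilityMeasure ν]
    {S : Set (X × Y)} (hS : MeasurableSet S) :
    (μ.prod ν).real S = ∫ x, ν.real (Prod.mk x ⁻¹' S) ∂μ := by
  rw [measureReal_def, Measure.prod_apply hS]
  exact (integral_toReal (measurable_measure_prodMk_left hS).aemeasurable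
    (Filter.Eventually.of_forall fun x => measure_lt_top _ _)).symm

/-! ### The events in terms of the standardized statistics -/

namespace Regression

variable {n p s : ℕ} (D : Regression n p s)

theorem continuous_βhat : Continuous D.βhat :=
  continuous_const.matrix_mulVec (continuous_const.matrix_mulVec (by fun_prop))

theorem continuous_τhat : Continuous D.τhat :=
  (continuous_const.matrix_mulVec D.continuous_βhat).sub continuous_const

theorem continuous_βstar : Continuous D.βstar :=
  D.continuous_βhat.sub (continuous_const.matrix_mulVec (continuous_const.matrix_mulVec
    (continuous_const.matrix_mulVec D.continuous_τhat)))

theorem continuous_R {f : EuclideanSpace ℝ (Fin n) → Fin p → ℝ} (hf : Continuous f) :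
    Continuous fun y => D.R y (f y) := by
  have h : Continuous fun y : EuclideanSpace ℝ (Fin n) => y.ofLp - D.X *ᵥ f y :=
    Continuous.sub (by fun_prop) (continuous_const.matrix_mulVec hf)
  exact h.dotProduct h

theorem continuous_sigmaHat (m : ℕ) : Continuous fun y => D.sigmaHat y m :=
  ((D.continuous_R D.continuous_βhat).div_const _).sqrt

theorem continuous_Θhat : Continuous D.Θhat := continuous_const.dotProduct D.continuous_βhat

theorem continuous_Θstar : Continuous D.Θstar := continuous_const.dotProduct D.continuous_βstar

theorem measurable_F (m : ℕ) : Measurable fun y => D.F y m := by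
  have h := D.continuous_βhat.sub D.continuous_βstar
  have h2 : Continuous fun y => (D.βhat y - D.βstar y) ⬝ᵥ (D.gram *ᵥ (D.βhat y - D.βstar y)) :=
    h.dotProduct (continuous_const.matrix_mulVec h)
  exact (h2.measurable.div_const _).div ((D.continuous_sigmaHat m).measurable.pow_const 2)

theorem measurableSet_mem_I (m : ℕ) (α θ : ℝ) : MeasurableSet {y | θ ∈ D.I y m α} := by
  have h1 := D.continuous_Θhat
  have h2 := D.continuous_sigmaHat m
  exact MeasurableSet.inter
    (measurableSet_le (h1.sub (continuous_const.mul h2)).measurable measurable_const)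
    (measurableSet_le measurable_const (h1.add (continuous_const.mul h2)).measurable)

theorem measurableSet_mem_J (m : ℕ) (α θ : ℝ) : MeasurableSet {y | θ ∈ D.J y m α} := by
  have h1 := D.continuous_Θstar
  have h2 := (((D.continuous_R D.continuous_βstar).div_const ((m : ℝ) + s)).sqrt.const_mul
    (tQuantile α (m + s))).mul_const √(D.v₁₁ - D.v₂₁ ⬝ᵥ (D.V₂₂⁻¹ *ᵥ D.v₂₁))
  exact MeasurableSet.inter
    (measurableSet_le (h1.sub h2).measurable measurable_const)
    (measurableSet_le measurable_const (h1.add h2).measurable)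

theorem measurable_response (β : Fin p → ℝ) (σ : ℝ) : Measurable (D.response β σ) := by
  unfold response
  fun_prop

theorem measurable_W (m : ℕ) (σ : ℝ) : Measurable fun y => D.W y m σ :=
  (D.continuous_sigmaHat m).measurable.div_const _

theorem measurable_errTau : Measurable D.errTau := by
  have : Continuous fun ε : EuclideanSpace ℝ (Fin n) => D.errMatrix *ᵥ ε.ofLp :=
    continuous_const.matrix_mulVec (by fun_prop)
  exact (WithLp.measurable_toLp 2 _).comp this.measurable

theorem measurable_residDir_dotProduct :
    Measurable fun ε : EuclideanSpace ℝ (Fin n) => D.residDir ⬝ᵥ ε.ofLp :=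
  (Continuous.dotProduct continuous_const (by fun_prop)).measurable

theorem isProbabilityMeasure_law (β : Fin p → ℝ) (σ : ℝ) : IsProbabilityMeasure (D.law β σ) := by
  unfold law
  infer_instance

theorem coverage_eq (m : ℕ) (α ℓ : ℝ) (β : Fin p → ℝ) (σ : ℝ) :
    D.coverage m α ℓ β σ = D.probI m α ℓ β σ + D.probJ m α ℓ β σ := by
  have := D.isProbabilityMeasure_law β σ
  have hF : MeasurableSet {y | D.F y m > ℓ} := measurableSet_lt measurable_const (D.measurable_F m)
  rw [coverage, ← measureReal_inter_add_sdiff hF, probI, probJ]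
  congr 2
  · ext y
    by_cases h : D.F y m > ℓ <;> simp [naiveCI, h]
  · ext y
    by_cases h : D.F y m > ℓ
    · simp [naiveCI, h]
    · simp [naiveCI, h, not_lt.1 h]

variable (β : Fin p → ℝ) {σ : ℝ} (ε : EuclideanSpace ℝ (Fin n))

theorem sigmaHat_eq (hσ : 0 < σ) (y : EuclideanSpace ℝ (Fin n)) (m : ℕ) :
    D.sigmaHat y m = σ * D.W y m σ := by
  rw [W, mul_div_cancel₀ _ hσ.ne']

theorem mem_I_response_iff (hσ : 0 < σ) (m : ℕ) (α : ℝ) :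
    D.θ β ∈ D.I (D.response β σ ε) m α ↔ D.residDir ⬝ᵥ ε.ofLp ∈ Set.Icc
      (-tQuantile α m * D.W (D.response β σ ε) m σ + -inner ℝ D.b (D.errTau ε))
      (tQuantile α m * D.W (D.response β σ ε) m σ + -inner ℝ D.b (D.errTau ε)) := by
  have hc : 0 < σ * √D.v₁₁ := mul_pos hσ (Real.sqrt_pos.2 D.v₁₁_pos)
  have h := D.Θhat_response β ε (σ := σ)
  rw [I, D.sigmaHat_eq hσ, Set.mem_Icc, Set.mem_Icc]
  set w := D.W (D.response β σ ε) m σ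
  set z := D.residDir ⬝ᵥ ε.ofLp
  set x := inner ℝ D.b (D.errTau ε)
  have e1 : D.Θhat (D.response β σ ε) - tQuantile α m * √D.v₁₁ * (σ * w) ≤ D.θ β ↔
      z ≤ tQuantile α m * w + -x := by
    rw [← sub_nonneg (b := D.Θhat (D.response β σ ε) - _),
      show D.θ β - (D.Θhat (D.response β σ ε) - tQuantile α m * √D.v₁₁ * (σ * w)) =
        σ * √D.v₁₁ * (tQuantile α m * w + -x - z) by linear_combination -h,
      mul_nonneg_iff_of_pos_left hc, sub_nonneg]
  have e2 : D.θ β ≤ D.Θhat (D.response β σ ε) + tQuantile α m * √D.v₁₁ * (σ * w) ↔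
      -tQuantile α m * w + -x ≤ z := by
    rw [← sub_nonneg,
      show D.Θhat (D.response β σ ε) + tQuantile α m * √D.v₁₁ * (σ * w) - D.θ β =
        σ * √D.v₁₁ * (z - (-tQuantile α m * w + -x)) by linear_combination h,
      mul_nonneg_iff_of_pos_left hc, sub_nonneg]
  rw [e1, e2, and_comm]

theorem R_βhat_eq (hσ : 0 < σ) (y : EuclideanSpace ℝ (Fin n)) {m : ℕ} (hm : 0 < m) :
    D.R y (D.βhat y) = σ ^ 2 * (m * D.W y m σ ^ 2) := by
  have hm' : (0 : ℝ) < m := by exact_mod_cast hm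
  have h0 : 0 ≤ D.R y (D.βhat y) / m := by
    refine div_nonneg ?_ hm'.le
    simpa [R] using dotProduct_star_self_nonneg (y.ofLp - D.X *ᵥ D.βhat y)
  have h1 : D.sigmaHat y m ^ 2 = D.R y (D.βhat y) / m := by rw [sigmaHat, Real.sq_sqrt h0]
  rw [D.sigmaHat_eq hσ] at h1
  field_simp at h1
  linear_combination -h1

/-- Divide `Θstar_response` by σ√v₁₁ > 0. The centre bᵀγ is constant, and h enters only through ‖γ +
h‖², by way of R(β*). -/
theorem mem_J_response_iff (hσ : 0 < σ) {m : ℕ} (hm : 0 < m) (α : ℝ) :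
    D.θ β ∈ D.J (D.response β σ ε) m α ↔ D.residDir ⬝ᵥ ε.ofLp ∈ Set.Icc
      (inner ℝ D.b (D.γ β σ) - tQuantile α (m + s) *
        √((m * D.W (D.response β σ ε) m σ ^ 2 + ‖D.γ β σ + D.errTau ε‖ ^ 2) / (m + s)) *
        √(1 - ‖D.b‖ ^ 2))
      (inner ℝ D.b (D.γ β σ) + tQuantile α (m + s) *
        √((m * D.W (D.response β σ ε) m σ ^ 2 + ‖D.γ β σ + D.errTau ε‖ ^ 2) / (m + s)) *
        √(1 - ‖D.b‖ ^ 2)) := by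
  have hc : 0 < σ * √D.v₁₁ := mul_pos hσ (Real.sqrt_pos.2 D.v₁₁_pos)
  have h := D.Θstar_response β ε hσ
  have hR : D.R (D.response β σ ε) (D.βstar (D.response β σ ε)) / (m + s) = σ ^ 2 *
      ((m * D.W (D.response β σ ε) m σ ^ 2 + ‖D.γ β σ + D.errTau ε‖ ^ 2) / (m + s)) := by
    rw [R_βstar, D.R_βhat_eq hσ _ hm, D.τhat_quadForm β ε hσ]
    ring
  rw [J, hR, v₁₁_sub, Real.sqrt_mul (sq_nonneg σ), Real.sqrt_sq hσ.le,
    Real.sqrt_mul D.v₁₁_pos.le, Set.mem_Icc, Set.mem_Icc]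
  set u := √((m * D.W (D.response β σ ε) m σ ^ 2 + ‖D.γ β σ + D.errTau ε‖ ^ 2) / (m + s))
  set v := √(1 - ‖D.b‖ ^ 2)
  set z := D.residDir ⬝ᵥ ε.ofLp
  set x := inner ℝ D.b (D.γ β σ)
  have e1 : D.Θstar (D.response β σ ε) - tQuantile α (m + s) * (σ * u) * (√D.v₁₁ * v) ≤ D.θ β ↔
      z ≤ x + tQuantile α (m + s) * u * v := by
    rw [← sub_nonneg (b := D.Θstar (D.response β σ ε) - _),
      show D.θ β - (D.Θstar (D.response β σ ε) - tQuantile α (m + s) * (σ * u) * (√D.v₁₁ * v)) =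
        σ * √D.v₁₁ * (x + tQuantile α (m + s) * u * v - z) by linear_combination -h,
      mul_nonneg_iff_of_pos_left hc, sub_nonneg]
  have e2 : D.θ β ≤ D.Θstar (D.response β σ ε) + tQuantile α (m + s) * (σ * u) * (√D.v₁₁ * v) ↔
      x - tQuantile α (m + s) * u * v ≤ z := by
    rw [← sub_nonneg,
      show D.Θstar (D.response β σ ε) + tQuantile α (m + s) * (σ * u) * (√D.v₁₁ * v) - D.θ β =
        σ * √D.v₁₁ * (z - (x - tQuantile α (m + s) * u * v)) by linear_combination h,
      mul_nonneg_iff_of_pos_left hc, sub_nonneg]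
  rw [e1, e2, and_comm]

/-- Positivity of W is essential: at W = 0 the quotient F takes the default value 0, and the
equivalence can fail. -/
theorem F_response_le_iff (hσ : 0 < σ) (hs : 0 < s) {m : ℕ} (ℓ : ℝ)
    (hW : 0 < D.W (D.response β σ ε) m σ) :
    D.F (D.response β σ ε) m ≤ ℓ ↔
      ‖D.γ β σ + D.errTau ε‖ ^ 2 ≤ s * ℓ * D.W (D.response β σ ε) m σ ^ 2 := by
  have hs' : (0 : ℝ) < s := by exact_mod_cast hs
  rw [F, βhat_sub_βstar_quadForm, D.τhat_quadForm β ε hσ, D.sigmaHat_eq hσ,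
    div_le_iff₀ (by positivity), div_le_iff₀ hs',
    show ℓ * (σ * D.W (D.response β σ ε) m σ) ^ 2 * s =
      σ ^ 2 * (s * ℓ * D.W (D.response β σ ε) m σ ^ 2) by ring, mul_le_mul_iff_right₀ (by positivity)]

theorem law_map_W {m : ℕ} (hn : n = p + m) (hσ : 0 < σ) :
    (D.law β σ).map (fun y => D.W y m σ) = scaledChiLaw m := by
  have := isProbabilityMeasure_scaledChiLaw m
  have hW := D.measurable_W m σ
  have he := D.measurable_errTau
  have hr := D.measurable_residDir_dotProduct
  have hresp := D.measurable_response β σ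
  have h := congrArg (fun μ => (μ.map Prod.fst).map Prod.snd) (D.stdGaussian_map_statistics β hn hσ)
  simp only at h
  rw [Measure.map_map (by fun_prop) (by fun_prop), Measure.map_map (by fun_prop) (by fun_prop),
    Measure.map_fst_prod, measure_univ, one_smul, Measure.map_snd_prod, measure_univ,
    one_smul] at h
  rw [D.law_eq_map_response β hσ, Measure.map_map hW hresp, ← h]
  rfl

/-- By independence, Z can be integrated out first, which leaves the Gaussian measure of the section
of S. The description of A by S is needed only where W > 0, an event of full probability. -/
theorem law_real_eq {m : ℕ} (hn : n = p + m) (hσ : 0 < σ) {A : Set (EuclideanSpace ℝ (Fin n))}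
    (hA : MeasurableSet A) {S : Set ((EuclideanSpace ℝ (Fin s) × ℝ) × ℝ)} (hS : MeasurableSet S)
    (hm : 0 < m)
    (hAS : ∀ ε, 0 < D.W (D.response β σ ε) m σ → (D.response β σ ε ∈ A ↔
      ((D.errTau ε, D.W (D.response β σ ε) m σ), D.residDir ⬝ᵥ ε.ofLp) ∈ S)) :
    (D.law β σ).real A = ∫ q, (gaussianReal 0 (1 - ‖D.b‖ ^ 2).toNNReal).real (Prod.mk q ⁻¹' S)
      ∂(stdGaussian (EuclideanSpace ℝ (Fin s))).prod (scaledChiLaw m) := by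
  have := isProbabilityMeasure_scaledChiLaw m
  have hW := D.measurable_W m σ
  have he := D.measurable_errTau
  have hr := D.measurable_residDir_dotProduct
  have hresp := D.measurable_response β σ
  have hpos : ∀ᵐ ε ∂stdGaussian (EuclideanSpace ℝ (Fin n)), 0 < D.W (D.response β σ ε) m σ := by
    have h1 := ae_pos_scaledChiLaw hm
    rw [← D.law_map_W β hn hσ, D.law_eq_map_response β hσ, Measure.map_map hW hresp,
      ae_map_iff (by fun_prop) measurableSet_Ioi] at h1
    exact h1
  rw [← measureReal_prod_eq_integral _ _ hS, ← D.stdGaussian_map_statistics β hn hσ,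
    map_measureReal_apply (by fun_prop) hS, D.law_eq_map_response β hσ,
    map_measureReal_apply hresp hA]
  refine measureReal_congr ?_
  filter_upwards [hpos] with ε hε
  exact propext (hAS ε hε)

end Regression

/-! ### Reduction to ‖b‖, ‖γ‖ and ψ -/

/-- The probability of `θ ∈ J` and `F ≤ ℓ` in canonical coordinates. -/
def acceptCover (m s : ℕ) (α ℓ B g ψ : ℝ) : ℝ :=
  ∫ w, ∫ q, (if q ≤ s * ℓ * w ^ 2 then jProb α m s B (B * g * ψ) q w else 0)
    ∂noncentralChiSquared s (g ^ 2) ∂scaledChiLaw m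

theorem acceptCover_eq_integral {m s : ℕ} (hm : 0 < m) (hs : 0 < s) {ℓ : ℝ} (hℓ : 0 < ℓ)
    (α B g ψ : ℝ) :
    acceptCover m s α ℓ B g ψ =
      ∫ w in Set.Ioi (0 : ℝ), ∫ q in (0 : ℝ)..(s * ℓ * w ^ 2),
        jProb α m s B (B * g * ψ) q w * fQ s g q * density (scaledChiLaw m) w := by
  have := isProbabilityMeasure_noncentralChiSquared s (g ^ 2)
  have hac := noncentralChiSquared_absolutelyContinuous hs (g ^ 2)
  rw [acceptCover, integral_scaledChiLaw hm]
  refine setIntegral_congr_fun measurableSet_Ioi fun w _ => ?_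
  simp only [intervalIntegral.integral_mul_const]
  congr 1
  rw [intervalIntegral.integral_of_le (by positivity), fQ,
    ← setIntegral_eq_setIntegral_mul_density hac measurableSet_Ioc,
    ← integral_indicator measurableSet_Ioc]
  refine integral_congr_ae ?_
  -- The interval integral runs over `Set.Ioc`, which leaves out q = 0; the law has no atom there.
  have h0 : ∀ᵐ q ∂noncentralChiSquared s (g ^ 2), q ≠ 0 :=
    hac.ae_le (Measure.ae_ne volume 0)
  filter_upwards [ae_nonneg_noncentralChiSquared s (g ^ 2), h0] with q hq hq0
  have hpos : 0 < q := lt_of_le_of_ne hq (Ne.symm hq0)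
  by_cases h : q ≤ s * ℓ * w ^ 2
  · rw [if_pos h, Set.indicator_of_mem (show q ∈ Set.Ioc 0 _ from ⟨hpos, h⟩)]
  · rw [if_neg h, Set.indicator_of_notMem fun h' => h h'.2]

namespace Regression

variable {n p s : ℕ} (D : Regression n p s) (β : Fin p → ℝ) {σ : ℝ}

theorem probI_eq_integral_rejectCover {m : ℕ} (hm : 0 < m) (hs : 0 < s) (hn : n = p + m)
    (hσ : 0 < σ) (α ℓ : ℝ) :
    D.probI m α ℓ β σ = ∫ h, rejectCover m s α ℓ ‖D.b‖ (‖D.γ β σ + h‖ ^ 2) (-inner ℝ D.b h)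
      ∂stdGaussian (EuclideanSpace ℝ (Fin s)) := by
  have := isProbabilityMeasure_scaledChiLaw m
  let S : Set ((EuclideanSpace ℝ (Fin s) × ℝ) × ℝ) := {q | q.2 ∈ Set.Icc
      (-tQuantile α m * q.1.2 + -inner ℝ D.b q.1.1) (tQuantile α m * q.1.2 + -inner ℝ D.b q.1.1) ∧
      s * ℓ * q.1.2 ^ 2 < ‖D.γ β σ + q.1.1‖ ^ 2}
  have hS : MeasurableSet S :=
    MeasurableSet.inter (MeasurableSet.inter
      (measurableSet_le (f := fun q : (EuclideanSpace ℝ (Fin s) × ℝ) × ℝ =>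
        -tQuantile α m * q.1.2 + -inner ℝ D.b q.1.1) (by fun_prop) measurable_snd)
      (measurableSet_le measurable_snd (g := fun q : (EuclideanSpace ℝ (Fin s) × ℝ) × ℝ =>
        tQuantile α m * q.1.2 + -inner ℝ D.b q.1.1) (by fun_prop)))
      (measurableSet_lt (f := fun q : (EuclideanSpace ℝ (Fin s) × ℝ) × ℝ => s * ℓ * q.1.2 ^ 2)
        (g := fun q => ‖D.γ β σ + q.1.1‖ ^ 2) (by fun_prop) (by fun_prop))
  have hA : MeasurableSet {y | D.θ β ∈ D.I y m α ∧ D.F y m > ℓ} :=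
    (D.measurableSet_mem_I m α _).inter (measurableSet_lt measurable_const (D.measurable_F m))
  rw [probI, D.law_real_eq β hn hσ hA hS hm fun ε hW => ?_]
  · rw [integral_congr_ae (g := fun q => if s * ℓ * q.2 ^ 2 < ‖D.γ β σ + q.1‖ ^ 2 then
      iProb α m ‖D.b‖ (-inner ℝ D.b q.1) q.2 else 0)
      (Filter.Eventually.of_forall fun q => ?_), integral_prod]
    · rfl
    · exact Integrable.of_bound (measurable_ite_iProb m s α ℓ ‖D.b‖ (by fun_prop) (by fun_prop)
        (by fun_prop)).aestronglyMeasurable 1 (Filter.Eventually.of_forall fun q =>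
          norm_ite_iProb_le ..)
    · by_cases h : s * ℓ * q.2 ^ 2 < ‖D.γ β σ + q.1‖ ^ 2
      · simp only [if_pos h, iProb]
        congr 1
        ext z
        simp [S, h]
      · simp only [if_neg h]
        have : Prod.mk q ⁻¹' S = ∅ := by
          ext z
          simp only [S, Set.mem_preimage, Set.mem_ofPred_eq, h, and_false, Set.mem_empty_iff_false]
        rw [this, measureReal_empty]
  · have h1 := D.mem_I_response_iff β ε hσ m α
    have h2 := D.F_response_le_iff β ε hσ hs ℓ hW
    simp only [Set.mem_ofPred_eq, S, h1, gt_iff_lt, ← not_le, h2]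

/-- The conventions for ψ do no harm: if b or γ is zero, both sides vanish. -/
theorem inner_b_γ : inner ℝ D.b (D.γ β σ) = ‖D.b‖ * ‖D.γ β σ‖ * D.ψ β σ := by
  unfold ψ
  split_ifs with h
  · simp [h]
  · rw [real_inner_smul_left, real_inner_smul_right]
    have hγ : ‖D.γ β σ‖ ≠ 0 := norm_ne_zero_iff.2 h
    by_cases hb : D.b = 0
    · simp [hb]
    · have hb' : ‖D.b‖ ≠ 0 := norm_ne_zero_iff.2 hb
      field_simp

/-- After Z is integrated out, h is made the inner variable, so that for fixed w the integral can be
pushed forward to the law of ‖γ + h‖². -/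
theorem probJ_eq_integral_jProb {m : ℕ} (hm : 0 < m) (hs : 0 < s) (hn : n = p + m)
    (hσ : 0 < σ) (α ℓ : ℝ) :
    D.probJ m α ℓ β σ = ∫ w, ∫ h, (if ‖D.γ β σ + h‖ ^ 2 ≤ s * ℓ * w ^ 2 then
        jProb α m s ‖D.b‖ (‖D.b‖ * ‖D.γ β σ‖ * D.ψ β σ) (‖D.γ β σ + h‖ ^ 2) w else 0)
      ∂stdGaussian (EuclideanSpace ℝ (Fin s)) ∂scaledChiLaw m := by
  have := isProbabilityMeasure_scaledChiLaw m
  rw [← inner_b_γ]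
  let r : EuclideanSpace ℝ (Fin s) × ℝ → ℝ := fun q => tQuantile α (m + s) *
    √((m * q.2 ^ 2 + ‖D.γ β σ + q.1‖ ^ 2) / (m + s)) * √(1 - ‖D.b‖ ^ 2)
  have hr : Measurable r := by fun_prop
  let S : Set ((EuclideanSpace ℝ (Fin s) × ℝ) × ℝ) := {q | q.2 ∈ Set.Icc
      (inner ℝ D.b (D.γ β σ) - r q.1) (inner ℝ D.b (D.γ β σ) + r q.1) ∧
      ‖D.γ β σ + q.1.1‖ ^ 2 ≤ s * ℓ * q.1.2 ^ 2}
  have hS : MeasurableSet S :=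
    MeasurableSet.inter (MeasurableSet.inter
      (measurableSet_le (f := fun q : (EuclideanSpace ℝ (Fin s) × ℝ) × ℝ =>
        inner ℝ D.b (D.γ β σ) - r q.1) (by fun_prop) measurable_snd)
      (measurableSet_le measurable_snd (g := fun q : (EuclideanSpace ℝ (Fin s) × ℝ) × ℝ =>
        inner ℝ D.b (D.γ β σ) + r q.1) (by fun_prop)))
      (measurableSet_le (g := fun q : (EuclideanSpace ℝ (Fin s) × ℝ) × ℝ => s * ℓ * q.1.2 ^ 2)
        (f := fun q => ‖D.γ β σ + q.1.1‖ ^ 2) (by fun_prop) (by fun_prop))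
  have hA : MeasurableSet {y | D.θ β ∈ D.J y m α ∧ D.F y m ≤ ℓ} :=
    (D.measurableSet_mem_J m α _).inter (measurableSet_le (D.measurable_F m) measurable_const)
  rw [probJ, D.law_real_eq β hn hσ hA hS hm fun ε hW => ?_]
  · rw [integral_congr_ae (g := fun q => if ‖D.γ β σ + q.1‖ ^ 2 ≤ s * ℓ * q.2 ^ 2 then
      jProb α m s ‖D.b‖ (inner ℝ D.b (D.γ β σ)) (‖D.γ β σ + q.1‖ ^ 2) q.2 else 0)
      (Filter.Eventually.of_forall fun q => ?_), integral_prod_symm]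
    · refine Integrable.of_bound (Measurable.ite (measurableSet_le (by fun_prop) (by fun_prop))
        (measurable_jProb α m s ‖D.b‖ _ (by fun_prop) (by fun_prop))
        measurable_const).aestronglyMeasurable 1 (Filter.Eventually.of_forall fun q => ?_)
      split_ifs
      · rw [Real.norm_of_nonneg (jProb_nonneg ..)]
        exact jProb_le_one ..
      · simp
    · by_cases h : ‖D.γ β σ + q.1‖ ^ 2 ≤ s * ℓ * q.2 ^ 2
      · simp only [if_pos h, jProb]
        congr 1
        ext z
        simp [S, h, r]
      · simp only [if_neg h]
        have : Prod.mk q ⁻¹' S = ∅ := by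
          ext z
          simp only [S, Set.mem_preimage, Set.mem_ofPred_eq, h, and_false, Set.mem_empty_iff_false]
        rw [this, measureReal_empty]
  · have h1 := D.mem_J_response_iff β ε hσ hm α
    have h2 := D.F_response_le_iff β ε hσ hs ℓ hW
    simp only [Set.mem_ofPred_eq, S, r, h1, h2]

theorem ψ_eq : D.ψ β σ = if D.γ β σ = 0 then 1
    else inner ℝ (‖D.b‖⁻¹ • D.b) (‖D.γ β σ‖⁻¹ • D.γ β σ) := by
  unfold ψ
  congr

end Regression

namespace Regression

variable {n p k : ℕ} (D : Regression n p (k + 2)) (β : Fin p → ℝ) {σ : ℝ}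

/-- `P(θ ∈ I, F > ℓ)` in canonical coordinates. -/
theorem probI_canonical {m : ℕ} (hm : 0 < m) (hn : n = p + m) (hσ : 0 < σ) (α ℓ : ℝ) :
    D.probI m α ℓ β σ = ∫ h, rejectCover m (k + 2) α ℓ ‖D.b‖
        (‖D.γ β σ‖ ^ 2 + 2 * ‖D.γ β σ‖ * h 0 + ‖h‖ ^ 2)
        (-(‖D.b‖ * (D.ψ β σ * h 0 + √(1 - D.ψ β σ ^ 2) * h 1)))
      ∂stdGaussian (EuclideanSpace ℝ (Fin (k + 2))) := by
  obtain ⟨L, hL⟩ := exists_rotation (D.γ β σ) D.b (D.ψ β σ) (D.ψ_eq β)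
  rw [D.probI_eq_integral_rejectCover β hm (by omega) hn hσ]
  -- The standard Gaussian law is rotation invariant, so h may be replaced by Lh.
  nth_rw 2 [← stdGaussian_map L]
  rw [integral_map (by fun_prop) (measurable_rejectCover m (k + 2) α ℓ _ (by fun_prop)
    (by fun_prop)).aestronglyMeasurable]
  refine integral_congr_ae (Filter.Eventually.of_forall fun h => ?_)
  simp only
  rw [norm_add_sq_eq_of_rotation (fun h => (hL h).1), (hL h).2]

/-- `P(θ ∈ J, F ≤ ℓ)` in canonical coordinates. -/
theorem probJ_canonical {m : ℕ} (hm : 0 < m) (hn : n = p + m) (hσ : 0 < σ) (α ℓ : ℝ) :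
    D.probJ m α ℓ β σ = acceptCover m (k + 2) α ℓ ‖D.b‖ ‖D.γ β σ‖ (D.ψ β σ) := by
  obtain ⟨L, hL⟩ := exists_rotation (D.γ β σ) D.b (D.ψ β σ) (D.ψ_eq β)
  rw [D.probJ_eq_integral_jProb β hm (by omega) hn hσ, acceptCover]
  refine integral_congr_ae (Filter.Eventually.of_forall fun w => ?_)
  simp only
  have hmeas : Measurable fun q => if q ≤ ((k + 2 : ℕ) : ℝ) * ℓ * w ^ 2 then
      jProb α m (k + 2) ‖D.b‖ (‖D.b‖ * ‖D.γ β σ‖ * D.ψ β σ) q w else 0 :=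
    Measurable.ite measurableSet_Iic (measurable_jProb α m _ _ _ measurable_id measurable_const)
      measurable_const
  rw [← stdGaussian_map_norm_add_sq (fun h => (hL h).1), integral_map (by fun_prop)
    hmeas.aestronglyMeasurable]

theorem fW_eq {m : ℕ} (hn : n = p + m) (hσ : 0 < σ) :
    D.fW m β σ = density (scaledChiLaw m) := by
  rw [fW, D.law_map_W β hn hσ]

theorem hasPDF_W {m : ℕ} (hm : 0 < m) (hn : n = p + m) (hσ : 0 < σ) :
    HasPDF (fun y => D.W y m σ) (D.law β σ) volume := by
  have := isProbabilityMeasure_scaledChiLaw m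
  rw [hasPDF_iff_of_aemeasurable (D.measurable_W m σ).aemeasurable, D.law_map_W β hn hσ]
  exact ⟨inferInstance, scaledChiLaw_absolutelyContinuous hm⟩

end Regression

theorem uFun_zero {s : ℕ} {ℓ : ℝ} (t : ℝ) {r : ℝ} (hr : 0 ≤ r) :
    uFun s ℓ 0 t r = r / √(s * ℓ) := by
  have h : dFun s 0 t r = r ^ 2 := by simp [dFun]
  rw [uFun, h, Real.sqrt_div (sq_nonneg r), Real.sqrt_sq hr]

end

/-! ### Assembly of the formulas -/

theorem theorem1 (m s : ℕ) (hm : 0 < m) (hs : 2 ≤ s) (α ℓ : ℝ) (hα₀ : 0 < α) (hα₁ : α < 1)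
    (hℓ : 0 < ℓ) :
    -- the densities `f_R`, `f_Q` exist
    chiLaw s ≪ volume ∧ (∀ g : ℝ, 0 ≤ g → noncentralChiSquared s (g ^ 2) ≪ volume) ∧
    (∀ (n p : ℕ) (_ : n = p + m) (D : Regression n p s) (β : Fin p → ℝ) (σ : ℝ) (_ : 0 < σ),
      -- the density `f_W` exists
      HasPDF (fun y => D.W y m σ) (D.law β σ) volume ∧
      D.coverage m α ℓ β σ = D.probI m α ℓ β σ + D.probJ m α ℓ β σ ∧
      D.probJ m α ℓ β σ =
        ∫ w in Set.Ioi (0 : ℝ), ∫ q in (0 : ℝ)..(s * ℓ * w ^ 2),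
          jProb α m s ‖D.b‖ (‖D.b‖ * ‖D.γ β σ‖ * D.ψ β σ) q w
            * fQ s ‖D.γ β σ‖ q * D.fW m β σ w ∧
      (s = 2 → D.probI m α ℓ β σ =
        ∫ t₁ in (0 : ℝ)..1, ∫ r in Set.Ioi (0 : ℝ), ∫ w in (0 : ℝ)..(uFun s ℓ ‖D.γ β σ‖ t₁ r),
          iProb α m ‖D.b‖ (-‖D.b‖ * r * kTwo (D.ψ β σ) t₁) w * D.fW m β σ w * fR s r) ∧
      (3 ≤ s → 0 < ‖D.γ β σ‖ → D.probI m α ℓ β σ =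
        ∫ t₂ in (0 : ℝ)..1, ∫ t₁ in (0 : ℝ)..1, ∫ r in Set.Ioi (0 : ℝ),
          ∫ w in (0 : ℝ)..(uFun s ℓ ‖D.γ β σ‖ t₁ r),
            iProb α m ‖D.b‖ (-‖D.b‖ * r * kFun s (D.ψ β σ) t₁ t₂) w
              * D.fW m β σ w * fR s r * fT₁ s t₁ * fT₂ s t₂) ∧
      (3 ≤ s → 0 < ‖D.γ β σ‖ → D.ψ β σ = -1 ∨ D.ψ β σ = 1 → D.probI m α ℓ β σ =
        ∫ t₁ in (0 : ℝ)..1, ∫ r in Set.Ioi (0 : ℝ), ∫ w in (0 : ℝ)..(uFun s ℓ ‖D.γ β σ‖ t₁ r),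
          iProb α m ‖D.b‖ (-‖D.b‖ * r * Real.cos (Real.pi * t₁)) w
            * D.fW m β σ w * fR s r * fT₁ s t₁) ∧
      (s = 2 → ‖D.γ β σ‖ = 0 → D.probI m α ℓ β σ =
        ∫ t₁ in (0 : ℝ)..1, ∫ r in Set.Ioi (0 : ℝ), ∫ w in (0 : ℝ)..(r / √(s * ℓ)),
          iProb α m ‖D.b‖ (-‖D.b‖ * r * Real.cos (2 * Real.pi * t₁)) w
            * D.fW m β σ w * fR s r) ∧
      (3 ≤ s → ‖D.γ β σ‖ = 0 → D.probI m α ℓ β σ =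
        ∫ t₁ in (0 : ℝ)..1, ∫ r in Set.Ioi (0 : ℝ), ∫ w in (0 : ℝ)..(r / √(s * ℓ)),
          iProb α m ‖D.b‖ (-‖D.b‖ * r * Real.cos (Real.pi * t₁)) w
            * D.fW m β σ w * fR s r * fT₁ s t₁)) ∧
    -- for given `‖b‖`, `m`, `s`, `ℓ`, `α`, the coverage is a function of `(‖γ‖, ψ)`
    ∃ cov : ℝ → ℝ → ℝ → ℝ,
      ∀ (n p : ℕ) (_ : n = p + m) (D : Regression n p s) (β : Fin p → ℝ) (σ : ℝ) (_ : 0 < σ),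
        D.coverage m α ℓ β σ = cov ‖D.b‖ ‖D.γ β σ‖ (D.ψ β σ) := by
  obtain ⟨k, rfl⟩ : ∃ k, s = k + 2 := ⟨s - 2, by omega⟩
  have hrej : ∀ B d x, rejectCover m (k + 2) α ℓ B d x = ∫ w in (0 : ℝ)..√(d / ((k + 2 : ℕ) * ℓ)),
      iProb α m B x w * density (scaledChiLaw m) w :=
    fun B d x => rejectCover_eq_intervalIntegral hm (by omega) hℓ α B d x
  refine ⟨chiLaw_absolutelyContinuous (by omega), fun g _ =>
    noncentralChiSquared_absolutelyContinuous (by omega) _, ?_, ?_⟩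
  · intro n p hn D β σ hσ
    have hI := D.probI_canonical β hm hn hσ α ℓ
    -- No condition on γ is imposed here or in `haxis`; the formulas for γ = 0 are their
    -- specializations at ψ = 1.
    have htwo : k + 2 = 2 → D.probI m α ℓ β σ =
        ∫ t₁ in (0 : ℝ)..1, ∫ r in Set.Ioi (0 : ℝ),
          ∫ w in (0 : ℝ)..(uFun (k + 2) ℓ ‖D.γ β σ‖ t₁ r),
          iProb α m ‖D.b‖ (-‖D.b‖ * r * kTwo (D.ψ β σ) t₁) w * D.fW m β σ w * fR (k + 2) r := by
      intro h2
      obtain rfl : k = 0 := by omega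
      rw [hI, integral_rejectCover_two, D.fW_eq β hn hσ]
      simp only [intervalIntegral.integral_mul_const]
      simp only [← hrej, uFun]
    have haxis : 3 ≤ k + 2 → D.ψ β σ = -1 ∨ D.ψ β σ = 1 → D.probI m α ℓ β σ =
        ∫ t₁ in (0 : ℝ)..1, ∫ r in Set.Ioi (0 : ℝ),
          ∫ w in (0 : ℝ)..(uFun (k + 2) ℓ ‖D.γ β σ‖ t₁ r),
          iProb α m ‖D.b‖ (-‖D.b‖ * r * Real.cos (Real.pi * t₁)) w
            * D.fW m β σ w * fR (k + 2) r * fT₁ (k + 2) t₁ := by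
      intro h3 hψ
      obtain ⟨j, rfl⟩ : ∃ j, k = j + 1 := ⟨k - 1, by omega⟩
      have h := integral_rejectCover_axis m j α ℓ ‖D.b‖ ‖D.γ β σ‖
      have h' : D.probI m α ℓ β σ = ∫ h, rejectCover m (j + 3) α ℓ ‖D.b‖
          (‖D.γ β σ‖ ^ 2 + 2 * ‖D.γ β σ‖ * h 0 + ‖h‖ ^ 2) (-(‖D.b‖ * h 0))
          ∂stdGaussian (EuclideanSpace ℝ (Fin (j + 3))) := by
        rw [hI]
        refine integral_congr_ae (Filter.Eventually.of_forall fun h => ?_)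
        -- For ψ = ±1 the coefficient √(1 - ψ²) of the second coordinate vanishes, and the sign is
        -- removed by `rejectCover_neg`.
        rcases hψ with hψ | hψ
        · simp only [hψ]
          rw [← rejectCover_neg]
          norm_num
        · simp [hψ]
      rw [h', h, D.fW_eq β hn hσ]
      simp only [intervalIntegral.integral_mul_const]
      simp only [← hrej, uFun]
    have hψ0 : ‖D.γ β σ‖ = 0 → D.ψ β σ = 1 := fun h => by
      rw [D.ψ_eq, if_pos (norm_eq_zero.1 h)]
    refine ⟨D.hasPDF_W β hm hn hσ, D.coverage_eq m α ℓ β σ, ?_, htwo, ?_,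
      fun h3 _ hψ => haxis h3 hψ, ?_, ?_⟩
    · rw [D.probJ_canonical β hm hn hσ, acceptCover_eq_integral hm (by omega) hℓ,
        D.fW_eq β hn hσ]
    · intro h3 _
      obtain ⟨j, rfl⟩ : ∃ j, k = j + 1 := ⟨k - 1, by omega⟩
      rw [hI, integral_rejectCover_of_three_le m j, D.fW_eq β hn hσ]
      simp only [intervalIntegral.integral_mul_const]
      simp only [← hrej, uFun]
    · intro h2 hγ
      rw [htwo h2, hγ, hψ0 hγ]
      refine intervalIntegral.integral_congr fun t _ => ?_
      refine setIntegral_congr_fun measurableSet_Ioi fun r hr => ?_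
      simp only [uFun_zero t (le_of_lt hr)]
      simp [kTwo]
    · intro h3 hγ
      rw [haxis h3 (Or.inr (hψ0 hγ)), hγ]
      refine intervalIntegral.integral_congr fun t _ => ?_
      refine setIntegral_congr_fun measurableSet_Ioi fun r hr => ?_
      simp only [uFun_zero t (le_of_lt hr)]
  -- The canonical integrals serve as the witness: they mention the regression only through ‖b‖, ‖γ‖
  -- and ψ, uniformly in n and p.
  · refine ⟨fun B g ψ => (∫ h, rejectCover m (k + 2) α ℓ B (g ^ 2 + 2 * g * h 0 + ‖h‖ ^ 2)
      (-(B * (ψ * h 0 + √(1 - ψ ^ 2) * h 1))) ∂stdGaussian (EuclideanSpace ℝ (Fin (k + 2)))) +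
      acceptCover m (k + 2) α ℓ B g ψ, fun n p hn D β σ hσ => ?_⟩
    rw [D.coverage_eq, D.probI_canonical β hm hn hσ, D.probJ_canonical β hm hn hσ]
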